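/- Notation. Write $z\in\mathbb C^N$ as a row vector. Let $\mathcal D_N$ be the set of complex symmetric $N\times N$ matrices $A$ with $A^*A<I$, and put $Q_A(z)=zAz^T$. For $A\in\mathcal D_N$, $w\in S^{2N-1}\subset\mathbb C^N$ and an integer $k\ge 1$ let $$\psi_{A,w}(z)=e^{kQ_A(z-w)/2}\,e^{kz\overline w^T}\,e^{-k|w|^2/2}\,e^{-k|z|^2/2}\quad(z\in\mathbb C^N),$$ $$\Psi_{A,w}(z)=\frac1{2\pi}\int_0^{2\pi}e^{-ikt}\,\psi_{A,w}(e^{it}z)\,dt\quad(z\in S^{2N-1}).$$ For $N=2$ let $|n\rangle=\frac1\pi\sqrt{\frac{k+1}2}\sqrt{\binom kn}\,z_1^n z_2^{k-n}$, $0\le n\le k$, as functions on $S^3$, and let $\|\cdot\|$ be the norm of $L^2(S^3)$ with respect to the surface measure. **Proposition 1.6.** (1) Let $\mu\in\mathbb C$ with $|\mu|<1$, and let $[\mu]=\begin{pmatrix}0&0\\0&\mu\end{pmatrix}$. Then for every $k\ge1$, on $S^3$, $$\Psi_{[\mu],(1,0)}=\pi k^k e^{-k}\sqrt{\frac2{(k+1)!}}\sum_{0\le\ell\le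 k/2}\Bigl(\frac1{2k}\Bigr)^{\ell}\frac1{\sqrt{(k-2\ell)!}}\sqrt{\binom{2\ell}{\ell}}\;\mu^\ell\,|k-2\ell\rangle .$$ (2) Let $A=\begin{pmatrix}a&c\\c&b\end{pmatrix}\in\mathcal D_2$ and $w=(1,0)$. Then $\operatorname{Re}(1+a)>0$, and if $\mu=b-\frac{c^2}{1+a}$, then $|\mu|<1$. This $\mu$ is the parameter of the symbol of $\Psi_{A,w}$: for all $\zeta\in\mathbb C$, with $\eta=(0,\zeta)$, $$\frac1{2\pi}e^{-|\eta|^2/2}\int_{-\infty}^\infty e^{Q_A(isw+\eta)/2}e^{-s^2/2}\,ds=\frac1{\sqrt{2\pi}}\frac1{\sqrt{1+a}}\,e^{\mu\zeta^2/2}e^{-|\zeta|^2/2},$$ where the square root is the principal one. Moreover $$\Psi_{A,w}=\frac1{\sqrt{1+a}}\,\Psi_{[\mu],(1,0)}\bigl(1+O(k^{-1/2})\bigr)\quad\text{in norm},$$ that is, $\Psi_{A,w}$ and $\Psi_{[\mu],(1,0)}$ lie in $L^2(S^3)$ and there is a constant $C$, depending only on $A$, such that for all $k\ge1$ $$\bigl\|\Psi_{A,w}-(1+a)^{-1/2}\,\Psi_{[\mu],(1,0)}\bigr\|\le\frac{C}{\sqrt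 k}\,\bigl\|\Psi_{[\mu],(1,0)}\bigr\| .$$ -/

import Mathlib

open MeasureTheory

namespace ReducedGaussian

/-- The generalized unit disk: complex symmetric `N × N` matrices `A` with `A* A < I`. -/
def Disk (N : ℕ) : Set (Matrix (Fin N) (Fin N) ℂ) :=
  open scoped ComplexOrder in
  {A | A.IsSymm ∧ (1 - A.conjTranspose * A).PosDef}

/-- The quadratic form `Q_A(z) = z A zᵀ`. -/
noncomputable def quadForm {N : ℕ} (A : Matrix (Fin N) (Fin N) ℂ)
    (z : EuclideanSpace ℂ (Fin N)) : ℂ :=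
  ∑ i, ∑ j, z i * A i j * z j

/-- The Gaussian coherent state
`ψ_{A,w}(z) = exp(k Q_A(z - w)/2) exp(k z w̄ᵀ) exp(-k |w|²/2) exp(-k |z|²/2)` on `ℂ^N`. -/
noncomputable def gaussianState {N : ℕ} (k : ℕ) (A : Matrix (Fin N) (Fin N) ℂ)
    (w z : EuclideanSpace ℂ (Fin N)) : ℂ :=
  Complex.exp (k * quadForm A (z - w) / 2) *
    Complex.exp (k * ∑ i, z i * (starRingEnd ℂ) (w i)) *
    Complex.exp (-k * (‖w‖ : ℂ) ^ 2 / 2) * Complex.exp (-k * (‖z‖ : ℂ) ^ 2 / 2)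

/-- The unit sphere `S^{2N-1}` in `ℂ^N`. -/
abbrev USphere (N : ℕ) : Type := Metric.sphere (0 : EuclideanSpace ℂ (Fin N)) 1

/-- The (non-normalized) surface measure of `S^{2N-1}`, of total mass `2 π^N / (N-1)!`. -/
noncomputable def surface (N : ℕ) : Measure (USphere N) :=
  (volume : Measure (EuclideanSpace ℂ (Fin N))).toSphere

/-- The quantum reduction operator
`R_k(ψ)(z) = (2π)⁻¹ ∫_0^{2π} e^{-ikt} ψ(e^{it} z) dt`, for `z` in the unit sphere. -/
noncomputable def reduction {N : ℕ} (k : ℕ) (ψ : EuclideanSpace ℂ (Fin N) → ℂ)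
    (z : USphere N) : ℂ :=
  1 / (2 * (Real.pi : ℂ)) * ∫ t in (0 : ℝ)..(2 * Real.pi),
    Complex.exp (-(Complex.I * k * t)) *
      ψ (Complex.exp (Complex.I * t) • (z : EuclideanSpace ℂ (Fin N)))

/-- The reduced Gaussian state `Ψ_{A,w} = R_k(ψ_{A,w})`. -/
noncomputable def reducedState {N : ℕ} (k : ℕ) (A : Matrix (Fin N) (Fin N) ℂ)
    (w : USphere N) : USphere N → ℂ :=
  reduction k (gaussianState k A (w : EuclideanSpace ℂ (Fin N)))

/-- The standard basis functions
`|n⟩ = π⁻¹ √((k+1)/2) √(k choose n) z₁ⁿ z₂^{k-n}`, `0 ≤ n ≤ k`, on `S³`. -/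
noncomputable def ket (k n : ℕ) (z : USphere 2) : ℂ :=
  ((1 / Real.pi * √(((k : ℝ) + 1) / 2) * √((k.choose n : ℕ) : ℝ) : ℝ) : ℂ) *
    (z : EuclideanSpace ℂ (Fin 2)) 0 ^ n * (z : EuclideanSpace ℂ (Fin 2)) 1 ^ (k - n)

/-- The point `(1, 0)` of `S³`. -/
noncomputable def north : USphere 2 :=
  ⟨EuclideanSpace.single 0 1, by simp⟩

/-- The symbol of `Ψ_{A,w}`, a function of `η` in the orthogonal complement of `ℂ w`:
`σ_A(η) = (2π)⁻¹ e^{-|η|²/2} ∫_ℝ e^{Q_A(i s w + η)/2} e^{-s²/2} ds`. -/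
noncomputable def gaussianSymbol {N : ℕ} (A : Matrix (Fin N) (Fin N) ℂ)
    (w : USphere N) (η : EuclideanSpace ℂ (Fin N)) : ℂ :=
  1 / (2 * (Real.pi : ℂ)) * Complex.exp (-(‖η‖ : ℂ) ^ 2 / 2) *
    ∫ s : ℝ, Complex.exp
        (quadForm A ((Complex.I * s) • (w : EuclideanSpace ℂ (Fin N)) + η) / 2) *
      Complex.exp (-(s : ℂ) ^ 2 / 2)

end ReducedGaussian

/-! On the unit sphere the averaged coherent state is the one-dimensional integral `reducedInt` of
exp(k (phase - it)) in the coordinates (x, y). For A = [μ] it is the degree k Fourier coefficient of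
a product of two exponentials, hence an exact finite sum (`reducedState_diag_eq_sum_ket`).

For general A, positivity of 1 - A*A and compactness give a spectral gap Re Q_A(v) ≤ (1 - δ)|v|².
This gap alone yields Re(1 + a) > 0, |μ| < 1 and Gaussian decay of the integrand. Equivariance under
the circle action reduces the analysis to points (r, ζ) with r ≥ 0, where the integrand concentrates
at t = 0, ζ = 0. There phase - it agrees with `modelPhase` up to third order, so Laplace's method
has error (C/k) exp(-κk|ζ|²) (`exists_norm_reducedInt_sub_le`). Completing the square in t shows
that the model integral for A is (1 + a)^(-1/2) times the one for [μ], where μ is the Schur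
complement (`integral_exp_modelPhase`). The two states therefore differ pointwise by the Laplace
error only.

The Gaussian has integral O(1/k) on S³, so the squared L² norm of the difference is O(k⁻³). On |y|²
≤ 1/(4k), a set of measure at least a multiple of 1/k, the ℓ = 0 term dominates the finite sum and
has size at least a multiple of k^(-1/2) by Stirling (`le_norm_reducedInt_diag`); so the squared
norm of the reference state is at least a multiple of k⁻². The quotient is O(1/k). -/

namespace ReducedGaussian

/-! ### Coordinates on the sphere and equivariance under the circle action. -/

/-- The exponent of the Gaussian coherent state centred at `(1, 0)` for `k = 1`, on the unit
sphere of `ℂ²`. -/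
noncomputable def phase (a b c u v : ℂ) : ℂ :=
  (a * (u - 1) ^ 2 + 2 * c * (u - 1) * v + b * v ^ 2) / 2 + u - 1

/-- The reduced Gaussian state centred at `(1, 0)`, in coordinates. -/
noncomputable def reducedInt (k : ℕ) (a b c x y : ℂ) : ℂ :=
  1 / (2 * (Real.pi : ℂ)) * ∫ t in (0 : ℝ)..(2 * Real.pi),
    Complex.exp (-(Complex.I * k * t)) *
      Complex.exp (k * phase a b c (Complex.exp (Complex.I * t) * x)
        (Complex.exp (Complex.I * t) * y))

theorem quadForm_two (a b c : ℂ) (z : EuclideanSpace ℂ (Fin 2)) :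
    quadForm !![a, c; c, b] z = a * z 0 ^ 2 + 2 * c * z 0 * z 1 + b * z 1 ^ 2 := by
  simp [quadForm, Fin.sum_univ_two]
  ring

theorem norm_exp_I_mul_ofReal (t : ℝ) : ‖Complex.exp (Complex.I * t)‖ = 1 := by
  rw [mul_comm]; exact Complex.norm_exp_ofReal_mul_I t

theorem reducedState_eq_reducedInt (k : ℕ) (a b c : ℂ) (z : USphere 2) :
    reducedState k !![a, c; c, b] north z =
      reducedInt k a b c ((z : EuclideanSpace ℂ (Fin 2)) 0)
        ((z : EuclideanSpace ℂ (Fin 2)) 1) := by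
  unfold reducedState reduction reducedInt
  congr 1
  apply intervalIntegral.integral_congr
  intro t _
  have hz : ‖(z : EuclideanSpace ℂ (Fin 2))‖ = 1 := by simp
  have hn : ‖(north : EuclideanSpace ℂ (Fin 2))‖ = 1 := by simp
  have h0 : (north : EuclideanSpace ℂ (Fin 2)) 0 = 1 := by simp [north]
  have h1 : (north : EuclideanSpace ℂ (Fin 2)) 1 = 0 := by simp [north]
  simp only [gaussianState, quadForm_two, norm_smul, norm_exp_I_mul_ofReal, hz, hn,
    Fin.sum_univ_two, PiLp.sub_apply, PiLp.smul_apply, h0, h1, smul_eq_mul]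
  rw [← Complex.exp_add, ← Complex.exp_add, ← Complex.exp_add]
  congr 2
  simp only [phase, map_one, map_zero, mul_one, Complex.ofReal_one]
  ring

theorem periodic_reducedInt_integrand (k : ℕ) (a b c x y : ℂ) :
    Function.Periodic (fun t : ℝ => Complex.exp (-(Complex.I * k * t)) *
      Complex.exp (k * phase a b c (Complex.exp (Complex.I * t) * x)
        (Complex.exp (Complex.I * t) * y))) (2 * Real.pi) := by
  intro t
  have e1 : Complex.exp (Complex.I * ((t + 2 * Real.pi : ℝ) : ℂ)) =
      Complex.exp (Complex.I * t) := by
    rw [show Complex.I * ((t + 2 * Real.pi : ℝ) : ℂ) =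
      Complex.I * t + 2 * Real.pi * Complex.I by push_cast; ring]
    exact Complex.exp_periodic _
  have e2 : Complex.exp (-(Complex.I * k * ((t + 2 * Real.pi : ℝ) : ℂ))) =
      Complex.exp (-(Complex.I * k * t)) := by
    rw [show -(Complex.I * k * ((t + 2 * Real.pi : ℝ) : ℂ)) =
      -(Complex.I * k * t) - (k : ℕ) * (2 * Real.pi * Complex.I) by push_cast; ring]
    exact Complex.exp_periodic.sub_nat_mul_eq k
  simp only [e1, e2]

/-- Translating t by θ turns the rotation into the character of weight k; periodicity restores the
interval. -/
theorem reducedInt_rotate (k : ℕ) (a b c x y : ℂ) (θ : ℝ) :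
    reducedInt k a b c (Complex.exp (Complex.I * θ) * x) (Complex.exp (Complex.I * θ) * y) =
      Complex.exp (Complex.I * k * θ) * reducedInt k a b c x y := by
  unfold reducedInt
  have hper := periodic_reducedInt_integrand k a b c x y
  set F : ℝ → ℂ := fun t => Complex.exp (-(Complex.I * k * t)) *
      Complex.exp (k * phase a b c (Complex.exp (Complex.I * t) * x)
        (Complex.exp (Complex.I * t) * y)) with hF
  have h1 : ∀ t : ℝ, Complex.exp (-(Complex.I * k * t)) *
      Complex.exp (k * phase a b c (Complex.exp (Complex.I * t) *
        (Complex.exp (Complex.I * θ) * x))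
        (Complex.exp (Complex.I * t) * (Complex.exp (Complex.I * θ) * y))) =
      Complex.exp (Complex.I * k * θ) * F (t + θ) := by
    intro t
    simp only [hF]
    have e1 : Complex.exp (Complex.I * ((t + θ : ℝ) : ℂ)) =
        Complex.exp (Complex.I * t) * Complex.exp (Complex.I * θ) := by
      rw [← Complex.exp_add]; push_cast; ring_nf
    have e2 : Complex.exp (-(Complex.I * k * t)) = Complex.exp (Complex.I * k * θ) *
        Complex.exp (-(Complex.I * k * ((t + θ : ℝ) : ℂ))) := by
      rw [← Complex.exp_add]; push_cast; ring_nf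
    rw [e1, e2]
    simp only [mul_assoc]
  simp only [h1]
  rw [intervalIntegral.integral_const_mul, intervalIntegral.integral_comp_add_right, zero_add,
    add_comm (2 * Real.pi) θ, hper.intervalIntegral_add_eq θ 0, zero_add]
  ring

/-! ### Exact expansion in the diagonal case. -/

theorem integral_exp_int_mul_I (n : ℤ) :
    ∫ t in (0 : ℝ)..(2 * Real.pi), Complex.exp (n * (Complex.I * t)) =
      if n = 0 then 2 * (Real.pi : ℂ) else 0 := by
  split_ifs with h
  · simp [h]
  · have hc : (n : ℂ) * Complex.I ≠ 0 := by simp [h]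
    have := integral_exp_mul_complex (a := 0) (b := 2 * Real.pi) hc
    simp only [mul_assoc] at this
    rw [this]
    have e : Complex.exp ((n : ℂ) * (Complex.I * ((2 * Real.pi : ℝ) : ℂ))) = 1 := by
      rw [← Complex.exp_int_mul_two_pi_mul_I n]
      push_cast; ring_nf
    rw [e]; simp

/-- The degree `k` part of `exp (α τ²) exp (β τ)`. -/
theorem integral_exp_mul_exp_sq (k : ℕ) (α β : ℂ) :
    1 / (2 * (Real.pi : ℂ)) * ∫ t in (0 : ℝ)..(2 * Real.pi),
      Complex.exp (-(Complex.I * k * t)) *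
        (Complex.exp (α * Complex.exp (Complex.I * t) ^ 2) *
          Complex.exp (β * Complex.exp (Complex.I * t))) =
      ∑ l ∈ Finset.range (k / 2 + 1),
        α ^ l / (l.factorial : ℂ) * (β ^ (k - 2 * l) / ((k - 2 * l).factorial : ℂ)) := by
  -- General term of the product of the two exponential series; its norm does not depend on t, so
  -- dominated convergence applies with a constant bound.
  set g : ℕ × ℕ → ℝ → ℂ := fun p t => Complex.exp (-(Complex.I * k * t)) *
    (((α * Complex.exp (Complex.I * t) ^ 2) ^ p.1 / (p.1.factorial : ℂ)) *
      ((β * Complex.exp (Complex.I * t)) ^ p.2 / (p.2.factorial : ℂ))) with hg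
  have hexp : ∀ w : ℂ, HasSum (fun n : ℕ => w ^ n / (n.factorial : ℂ)) (Complex.exp w) := by
    intro w
    rw [Complex.exp_eq_exp_ℂ]
    exact NormedSpace.expSeries_div_hasSum_exp w
  have hn : ∀ w : ℂ, Summable (fun n : ℕ => ‖w ^ n / (n.factorial : ℂ)‖) :=
    fun w => NormedSpace.norm_expSeries_div_summable w
  have hint : ∀ p : ℕ × ℕ, ∫ t in (0 : ℝ)..(2 * Real.pi), g p t =
      if 2 * p.1 + p.2 = k then 2 * (Real.pi : ℂ) *
        (α ^ p.1 / (p.1.factorial : ℂ) * (β ^ p.2 / (p.2.factorial : ℂ))) else 0 := by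
    intro p
    have : ∀ t : ℝ, g p t = (α ^ p.1 / (p.1.factorial : ℂ) * (β ^ p.2 / (p.2.factorial : ℂ))) *
        Complex.exp (((2 * p.1 + p.2 - k : ℤ) : ℂ) * (Complex.I * t)) := by
      intro t
      simp only [hg, mul_pow]
      have e : Complex.exp (((2 * p.1 + p.2 - k : ℤ) : ℂ) * (Complex.I * t)) =
          Complex.exp (-(Complex.I * k * t)) * ((Complex.exp (Complex.I * t) ^ 2) ^ p.1 *
            Complex.exp (Complex.I * t) ^ p.2) := by
        rw [← pow_mul, ← Complex.exp_nat_mul, ← Complex.exp_nat_mul, ← Complex.exp_add,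
          ← Complex.exp_add]
        push_cast; ring_nf
      rw [e]; ring
    simp only [this]
    rw [intervalIntegral.integral_const_mul, integral_exp_int_mul_I]
    by_cases h : 2 * p.1 + p.2 = k
    · rw [if_pos (by omega), if_pos h]; ring
    · rw [if_neg (by omega), if_neg h]; simp
  have hbound : ∀ p : ℕ × ℕ, ∀ t : ℝ, ‖g p t‖ =
      ‖α ^ p.1 / (p.1.factorial : ℂ)‖ * ‖β ^ p.2 / (p.2.factorial : ℂ)‖ := by
    intro p t
    have e : ‖Complex.exp (-(Complex.I * k * t))‖ = 1 := by
      rw [show -(Complex.I * k * t) = Complex.I * ((-(k * t) : ℝ) : ℂ) by push_cast; ring]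
      exact norm_exp_I_mul_ofReal _
    simp [hg, e]
  have hS : HasSum (fun p : ℕ × ℕ => ∫ t in (0 : ℝ)..(2 * Real.pi), g p t)
      (∫ t in (0 : ℝ)..(2 * Real.pi), Complex.exp (-(Complex.I * k * t)) *
        (Complex.exp (α * Complex.exp (Complex.I * t) ^ 2) *
          Complex.exp (β * Complex.exp (Complex.I * t)))) := by
    refine intervalIntegral.hasSum_integral_of_dominated_convergence
      (bound := fun p _ => ‖α ^ p.1 / (p.1.factorial : ℂ)‖ * ‖β ^ p.2 / (p.2.factorial : ℂ)‖)
      ?_ ?_ ?_ ?_ ?_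
    · intro p
      apply Continuous.aestronglyMeasurable
      simp only [hg]; fun_prop
    · intro p
      exact Filter.Eventually.of_forall fun t _ => (hbound p t).le
    · exact Filter.Eventually.of_forall fun t _ =>
        (hn α).mul_of_nonneg (hn β) (fun _ => norm_nonneg _) (fun _ => norm_nonneg _)
    · exact intervalIntegrable_const
    · refine Filter.Eventually.of_forall fun t _ => ?_
      have h1 := summable_mul_of_summable_norm (hn (α * Complex.exp (Complex.I * t) ^ 2))
        (hn (β * Complex.exp (Complex.I * t)))
      have h2 := (hexp (α * Complex.exp (Complex.I * t) ^ 2)).mul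
        (hexp (β * Complex.exp (Complex.I * t))) h1
      simp only [hg]
      exact h2.mul_left _
  -- Orthogonality keeps only the pairs (l, q) with 2l + q = k, that is l ≤ k/2 and q = k - 2l,
  -- where the natural subtraction is not truncated.
  have hS' : HasSum (fun p : ℕ × ℕ => ∫ t in (0 : ℝ)..(2 * Real.pi), g p t)
      (∑ l ∈ Finset.range (k / 2 + 1), 2 * (Real.pi : ℂ) *
        (α ^ l / (l.factorial : ℂ) * (β ^ (k - 2 * l) / ((k - 2 * l).factorial : ℂ)))) := by
    have hinj : Set.InjOn (fun l : ℕ => (l, k - 2 * l))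
        (Finset.range (k / 2 + 1) : Set ℕ) := by
      intro a _ b _ h
      simp only [Prod.mk.injEq] at h
      exact h.1
    have hsum : HasSum (fun p : ℕ × ℕ => ∫ t in (0 : ℝ)..(2 * Real.pi), g p t)
        (∑ p ∈ (Finset.range (k / 2 + 1)).image (fun l => (l, k - 2 * l)),
          ∫ t in (0 : ℝ)..(2 * Real.pi), g p t) := by
      apply hasSum_sum_of_ne_finset_zero
      rintro ⟨p, q⟩ hb
      rw [hint, if_neg]
      intro h
      apply hb
      simp only [Finset.mem_image, Finset.mem_range, Prod.mk.injEq]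
      simp only at h
      exact ⟨p, by omega, rfl, by omega⟩
    rw [Finset.sum_image hinj] at hsum
    have heq : ∀ l ∈ Finset.range (k / 2 + 1),
        ∫ t in (0 : ℝ)..(2 * Real.pi), g (l, k - 2 * l) t = 2 * (Real.pi : ℂ) *
        (α ^ l / (l.factorial : ℂ) * (β ^ (k - 2 * l) / ((k - 2 * l).factorial : ℂ))) := by
      intro l hl
      rw [Finset.mem_range] at hl
      rw [hint, if_pos (by simp only; omega)]
    rwa [Finset.sum_congr rfl heq] at hsum
  rw [hS.unique hS', ← Finset.mul_sum, ← mul_assoc, one_div, inv_mul_cancel₀, one_mul]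
  simp [Real.pi_ne_zero]

theorem reducedInt_diag (k : ℕ) (μ x y : ℂ) :
    reducedInt k 0 μ 0 x y = Complex.exp (-k) * ∑ l ∈ Finset.range (k / 2 + 1),
        (k * μ * y ^ 2 / 2) ^ l / (l.factorial : ℂ) *
          ((k * x) ^ (k - 2 * l) / ((k - 2 * l).factorial : ℂ)) := by
  rw [← integral_exp_mul_exp_sq, mul_left_comm, ← intervalIntegral.integral_const_mul, reducedInt]
  congr 1
  apply intervalIntegral.integral_congr
  intro t _
  simp only
  rw [mul_left_comm]
  congr 1
  rw [← Complex.exp_add, ← Complex.exp_add, phase]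
  congr 1
  ring

theorem reducedState_diag_eq_sum_ket (μ : ℂ) (k : ℕ) (hk : 1 ≤ k) (z : USphere 2) :
    reducedState k !![0, 0; 0, μ] north z =
        ((Real.pi * (k : ℝ) ^ k * Real.exp (-(k : ℝ)) *
            √(2 / (((k + 1).factorial : ℕ) : ℝ)) : ℝ) : ℂ) *
          ∑ l ∈ Finset.range (k / 2 + 1),
            (1 / (2 * (k : ℂ))) ^ l *
              ((1 / √(((k - 2 * l).factorial : ℕ) : ℝ) : ℝ) : ℂ) *
              ((√(((2 * l).choose l : ℕ) : ℝ) : ℝ) : ℂ) * μ ^ l *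
              ket k (k - 2 * l) z := by
  rw [reducedState_eq_reducedInt, reducedInt_diag, Finset.mul_sum, Finset.mul_sum]
  refine Finset.sum_congr rfl fun l hl => ?_
  rw [Finset.mem_range] at hl
  have hlk : 2 * l ≤ k := by omega
  have hk0 : (k : ℂ) ≠ 0 := by exact_mod_cast (by omega : k ≠ 0)
  unfold ket
  rw [Nat.sub_sub_self hlk]
  -- All square roots combine: under one root the factors (k+1)!, (2l)! and π cancel and a perfect
  -- square is left.
  have key : Real.pi * √(2 / (((k + 1).factorial : ℕ) : ℝ)) *
      ((1 / √(((k - 2 * l).factorial : ℕ) : ℝ)) * √(((2 * l).choose l : ℕ) : ℝ) *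
      (1 / Real.pi * √(((k : ℝ) + 1) / 2) * √((k.choose (k - 2 * l) : ℕ) : ℝ))) =
      1 / ((l.factorial : ℝ) * ((k - 2 * l).factorial : ℝ)) := by
    have hp := Real.pi_ne_zero
    have e : √(2 / (((k + 1).factorial : ℕ) : ℝ)) *
      ((1 / √(((k - 2 * l).factorial : ℕ) : ℝ)) * √(((2 * l).choose l : ℕ) : ℝ) *
      (√(((k : ℝ) + 1) / 2) * √((k.choose (k - 2 * l) : ℕ) : ℝ))) =
      1 / ((l.factorial : ℝ) * ((k - 2 * l).factorial : ℝ)) := by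
      rw [← Real.sqrt_one, ← Real.sqrt_div (by norm_num), ← Real.sqrt_mul (by positivity),
        ← Real.sqrt_mul (by positivity), ← Real.sqrt_mul (by positivity),
        ← Real.sqrt_mul (by positivity), Real.sqrt_one,
        Real.sqrt_eq_iff_mul_self_eq (by positivity) (by positivity),
        Nat.cast_choose ℝ (by omega : l ≤ 2 * l), Nat.cast_choose ℝ (by omega : k - 2 * l ≤ k),
        Nat.sub_sub_self hlk, (by omega : 2 * l - l = l), Nat.factorial_succ]
      push_cast
      field_simp
    rw [← e]
    field_simp
  have hpow : (k : ℂ) ^ k = (k : ℂ) ^ (k - 2 * l) * (k : ℂ) ^ (2 * l) := by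
    rw [← pow_add]; congr 1; omega
  have keyC := congrArg (fun x : ℝ => (x : ℂ)) key
  set z0 := (z : EuclideanSpace ℂ (Fin 2)) 0
  set z1 := (z : EuclideanSpace ℂ (Fin 2)) 1
  have e1 : Complex.exp (-k) * ((k * μ * z1 ^ 2 / 2) ^ l / (l.factorial : ℂ) *
      ((k * z0) ^ (k - 2 * l) / ((k - 2 * l).factorial : ℂ))) =
      (k : ℂ) ^ k * Complex.exp (-k) * ((1 / (2 * (k : ℂ))) ^ l * μ ^ l * z0 ^ (k - 2 * l) *
        z1 ^ (2 * l)) * ((1 / ((l.factorial : ℝ) * ((k - 2 * l).factorial : ℝ)) : ℝ) : ℂ) := by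
    rw [hpow]
    push_cast
    simp only [mul_pow, div_pow, one_pow, pow_mul]
    field_simp
    ring
  rw [e1, ← keyC]
  push_cast
  ring

/-! ### Spectral gap of the disk and the Schur complement. -/

/-- Positivity of 1 - A*A says |Av| < |v| for v ≠ 0; then Cauchy–Schwarz applied to v · Av suffices.
-/
theorem re_quadForm_lt_of_mem_disk {a b c : ℂ} (h : !![a, c; c, b] ∈ Disk 2) {x y : ℂ}
    (hxy : x ≠ 0 ∨ y ≠ 0) :
    (a * x ^ 2 + 2 * c * x * y + b * y ^ 2).re < ‖x‖ ^ 2 + ‖y‖ ^ 2 := by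
  have hv : (![x, y] : Fin 2 → ℂ) ≠ 0 := by
    intro h0
    have e0 := congrFun h0 0
    have e1 := congrFun h0 1
    simp at e0 e1
    tauto
  open scoped ComplexOrder in
  have hpos : (0 : ℂ) < star ![x, y] ⬝ᵥ
      ((1 - (!![a, c; c, b] : Matrix (Fin 2) (Fin 2) ℂ).conjTranspose * !![a, c; c, b]).mulVec
        ![x, y]) :=
    Matrix.PosDef.dotProduct_mulVec_pos h.2 hv
  have hre := (Complex.lt_def.mp hpos).1
  have key : ‖a * x + c * y‖ ^ 2 + ‖c * x + b * y‖ ^ 2 < ‖x‖ ^ 2 + ‖y‖ ^ 2 := by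
    have e : (star ![x, y] ⬝ᵥ
      ((1 - (!![a, c; c, b] : Matrix (Fin 2) (Fin 2) ℂ).conjTranspose * !![a, c; c, b]).mulVec
        ![x, y])).re = ‖x‖ ^ 2 + ‖y‖ ^ 2 - (‖a * x + c * y‖ ^ 2 + ‖c * x + b * y‖ ^ 2) := by
      simp only [← Complex.normSq_eq_norm_sq]
      simp [Complex.normSq_apply, Matrix.mulVec, dotProduct, Fin.sum_univ_two, Matrix.mul_apply]
      ring
    rw [e] at hre
    simp at hre
    linarith
  have h1 : (a * x ^ 2 + 2 * c * x * y + b * y ^ 2).re ≤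
      ‖x‖ * ‖a * x + c * y‖ + ‖y‖ * ‖c * x + b * y‖ := by
    calc (a * x ^ 2 + 2 * c * x * y + b * y ^ 2).re
        ≤ ‖a * x ^ 2 + 2 * c * x * y + b * y ^ 2‖ := Complex.re_le_norm _
      _ = ‖x * (a * x + c * y) + y * (c * x + b * y)‖ := by ring_nf
      _ ≤ _ := by
        refine (norm_add_le _ _).trans ?_
        rw [norm_mul, norm_mul]
  nlinarith [sq_nonneg (‖x‖ - ‖a * x + c * y‖), sq_nonneg (‖y‖ - ‖c * x + b * y‖)]

theorem exists_re_quadForm_le_of_mem_disk {a b c : ℂ} (h : !![a, c; c, b] ∈ Disk 2) :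
    ∃ δ : ℝ, 0 < δ ∧ ∀ x y : ℂ,
      (a * x ^ 2 + 2 * c * x * y + b * y ^ 2).re ≤ (1 - δ) * (‖x‖ ^ 2 + ‖y‖ ^ 2) := by
  -- `ℂ × ℂ` carries the sup norm, so the Euclidean unit sphere is written out by its equation. The
  -- gap δ is one minus the maximum on it, and homogeneity of degree two does the rest.
  set S : Set (ℂ × ℂ) := {p | ‖p.1‖ ^ 2 + ‖p.2‖ ^ 2 = 1} with hS
  have hScl : IsClosed S := isClosed_eq (by fun_prop) (by fun_prop)
  have hSc : IsCompact S := by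
    refine Metric.isCompact_of_isClosed_isBounded hScl
      ((Metric.isBounded_closedBall (x := (0 : ℂ × ℂ)) (r := 1)).subset ?_)
    intro p hp
    rw [hS, Set.mem_ofPred_eq] at hp
    rw [mem_closedBall_zero_iff, Prod.norm_def, max_le_iff]
    constructor <;> nlinarith [norm_nonneg p.1, norm_nonneg p.2, sq_nonneg ‖p.1‖, sq_nonneg ‖p.2‖]
  have hne : S.Nonempty := ⟨(1, 0), by simp [hS]⟩
  obtain ⟨p, hp, hmax⟩ := hSc.exists_isMaxOn hne
    (f := fun p : ℂ × ℂ => (a * p.1 ^ 2 + 2 * c * p.1 * p.2 + b * p.2 ^ 2).re) (by fun_prop)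
  have hp0 : p.1 ≠ 0 ∨ p.2 ≠ 0 := by
    by_contra! hcon
    simp [hS, hcon.1, hcon.2] at hp
  have hlt := re_quadForm_lt_of_mem_disk h hp0
  rw [hS, Set.mem_ofPred_eq] at hp
  rw [hp] at hlt
  refine ⟨1 - (a * p.1 ^ 2 + 2 * c * p.1 * p.2 + b * p.2 ^ 2).re, by linarith, fun x y => ?_⟩
  rw [sub_sub_cancel]
  set n : ℝ := √(‖x‖ ^ 2 + ‖y‖ ^ 2) with hn
  have hnsq : n ^ 2 = ‖x‖ ^ 2 + ‖y‖ ^ 2 := Real.sq_sqrt (by positivity)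
  rw [← hnsq]
  rcases eq_or_ne n 0 with h0 | h0
  · rw [h0] at hnsq
    have hx : x = 0 := by
      have : ‖x‖ ^ 2 = 0 := by nlinarith [sq_nonneg ‖x‖, sq_nonneg ‖y‖]
      simpa using this
    have hy : y = 0 := by
      have : ‖y‖ ^ 2 = 0 := by nlinarith [sq_nonneg ‖x‖, sq_nonneg ‖y‖]
      simpa using this
    simp [hx, hy, h0]
  · have hn0 : (n : ℂ) ≠ 0 := by exact_mod_cast h0
    have hmem : (x / n, y / n) ∈ S := by
      simp only [hS, Set.mem_ofPred_eq, norm_div, Complex.norm_real, div_pow, Real.norm_eq_abs,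
        sq_abs]
      rw [← add_div, ← hnsq]
      field_simp
    have hle := hmax hmem
    simp only [Set.mem_ofPred_eq] at hle
    have e : a * x ^ 2 + 2 * c * x * y + b * y ^ 2 = ((n ^ 2 : ℝ) : ℂ) *
        (a * (x / n) ^ 2 + 2 * c * (x / n) * (y / n) + b * (y / n) ^ 2) := by
      push_cast
      field_simp
    rw [e, Complex.re_ofReal_mul, mul_comm]
    gcongr

theorem re_one_add_pos {a b c : ℂ} {δ : ℝ} (hδ : 0 < δ) (h : ∀ x y : ℂ,
    (a * x ^ 2 + 2 * c * x * y + b * y ^ 2).re ≤ (1 - δ) * (‖x‖ ^ 2 + ‖y‖ ^ 2)) :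
    0 < (1 + a).re := by
  have := h Complex.I 0
  simp at this
  simp
  linarith

/-- `Re (β² / α) ≤ (Re β)² / Re α` for `Re α > 0`. -/
theorem re_sq_div_le {α β : ℂ} (hα : 0 < α.re) : (β ^ 2 / α).re ≤ β.re ^ 2 / α.re := by
  have hn : 0 < Complex.normSq α := Complex.normSq_pos.mpr (by rintro rfl; simp at hα)
  rw [Complex.div_re, ← add_div, div_le_div_iff₀ hn hα]
  rw [Complex.normSq_apply]
  simp only [sq, Complex.mul_re, Complex.mul_im]
  nlinarith [sq_nonneg (β.im * α.re - β.re * α.im)]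

/-- The gap is tested on (is, ζ), with ζ a unit number making μζ² = |μ| and s maximizing the
resulting real quadratic; by `re_sq_div_le` that maximum is at least Re(μζ²). -/
theorem norm_schur_lt_one {a b c : ℂ} {δ : ℝ} (hδ : 0 < δ) (h : ∀ x y : ℂ,
    (a * x ^ 2 + 2 * c * x * y + b * y ^ 2).re ≤ (1 - δ) * (‖x‖ ^ 2 + ‖y‖ ^ 2)) :
    ‖b - c ^ 2 / (1 + a)‖ < 1 := by
  have hα := re_one_add_pos hδ h
  set μ := b - c ^ 2 / (1 + a) with hμdef
  obtain ⟨ζ, hζ, hμζ⟩ : ∃ ζ : ℂ, ‖ζ‖ = 1 ∧ (μ * ζ ^ 2).re = ‖μ‖ := by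
    refine ⟨Complex.exp (Complex.I * ((-(μ.arg) / 2 : ℝ) : ℂ)), norm_exp_I_mul_ofReal _, ?_⟩
    rw [← Complex.exp_nat_mul]
    nth_rewrite 1 [← Complex.norm_mul_exp_arg_mul_I μ]
    rw [mul_assoc, ← Complex.exp_add]
    have : μ.arg * Complex.I + ((2 : ℕ) : ℂ) * (Complex.I * ((-(μ.arg) / 2 : ℝ) : ℂ)) = 0 := by
      push_cast; ring
    rw [this]; simp
  set s : ℝ := (Complex.I * c * ζ).re / (1 + a).re with hs
  have h1 := h (Complex.I * s) ζ
  have hns : ‖Complex.I * (s : ℂ)‖ ^ 2 = s ^ 2 := by simp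
  rw [hns, hζ] at h1
  have e1 : (a * (Complex.I * s) ^ 2 + 2 * c * (Complex.I * s) * ζ + b * ζ ^ 2).re =
      s ^ 2 - s ^ 2 * (1 + a).re + 2 * s * (Complex.I * c * ζ).re + (b * ζ ^ 2).re := by
    have : a * (Complex.I * s) ^ 2 + 2 * c * (Complex.I * s) * ζ + b * ζ ^ 2 =
      ((s ^ 2 : ℝ) : ℂ) - ((s ^ 2 : ℝ) : ℂ) * (1 + a) + ((2 * s : ℝ) : ℂ) * (Complex.I * c * ζ)
        + b * ζ ^ 2 := by
      push_cast
      linear_combination a * (s : ℂ) ^ 2 * Complex.I_sq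
    rw [this]
    simp only [Complex.add_re, Complex.sub_re, Complex.re_ofReal_mul, Complex.ofReal_re]
  have e2 : (μ * ζ ^ 2).re = (b * ζ ^ 2).re + ((Complex.I * c * ζ) ^ 2 / (1 + a)).re := by
    rw [← Complex.add_re]
    congr 1
    rw [hμdef, mul_pow, mul_pow, Complex.I_sq]
    ring
  have h2 := re_sq_div_le (α := 1 + a) (β := Complex.I * c * ζ) hα
  have e3 : s * (1 + a).re = (Complex.I * c * ζ).re := by rw [hs]; field_simp
  have e4 : (Complex.I * c * ζ).re ^ 2 / (1 + a).re = s * (Complex.I * c * ζ).re := by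
    rw [hs]; ring
  rw [e4] at h2
  have : s ^ 2 * (1 + a).re = s * (Complex.I * c * ζ).re := by rw [← e3]; ring
  rw [← hμζ, e2]
  nlinarith [sq_nonneg s]

/-- The matrix [μ] has the gap 1 - |μ|, so the estimates below apply to it as well. -/
theorem re_diag_le (μ x y : ℂ) :
    ((0 : ℂ) * x ^ 2 + 2 * 0 * x * y + μ * y ^ 2).re ≤ (1 - (1 - ‖μ‖)) * (‖x‖ ^ 2 + ‖y‖ ^ 2) := by
  have : (μ * y ^ 2).re ≤ ‖μ‖ * ‖y‖ ^ 2 := by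
    refine (Complex.re_le_norm _).trans ?_
    rw [norm_mul, norm_pow]
  simp only [zero_mul, mul_zero, zero_add, sub_sub_cancel]
  nlinarith [mul_nonneg (norm_nonneg μ) (sq_nonneg ‖x‖)]

/-! ### The Gaussian model integral and the symbol. -/

/-- The quadratic part of the phase at the critical point. -/
noncomputable def modelPhase (a b c : ℂ) (t : ℝ) (ζ : ℂ) : ℂ :=
  (a * (Complex.I * t) ^ 2 + 2 * c * (Complex.I * t) * ζ + b * ζ ^ 2) / 2 -
    (t : ℂ) ^ 2 / 2 - (‖ζ‖ : ℂ) ^ 2 / 2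

theorem modelPhase_eq (a b c : ℂ) (t : ℝ) (ζ : ℂ) : modelPhase a b c t ζ =
    -((1 + a) / 2) * t ^ 2 + Complex.I * c * ζ * t + (b * ζ ^ 2 - (‖ζ‖ : ℂ) ^ 2) / 2 := by
  rw [modelPhase, mul_pow, Complex.I_sq]; ring

theorem integrable_exp_modelPhase {a b c : ℂ} (ha : 0 < (1 + a).re) (ζ : ℂ) {K : ℝ} (hK : 0 < K) :
    Integrable (fun t : ℝ => Complex.exp (K * modelPhase a b c t ζ)) := by
  have h : 0 < (K * (1 + a) / 2 : ℂ).re := by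
    rw [mul_div_assoc, Complex.re_ofReal_mul, Complex.div_ofNat_re]; positivity
  convert integrable_cexp_quadratic h (K * (Complex.I * c * ζ))
    (K * ((b * ζ ^ 2 - (‖ζ‖ : ℂ) ^ 2) / 2)) using 2
  rw [modelPhase_eq]; ring_nf

/-- Completing the square in t adds (icζ)²/(1 + a) to bζ², which turns b into the Schur complement.
K = 1 gives the symbol, K = k the Laplace approximation. -/
theorem integral_exp_modelPhase {a b c : ℂ} (ha : 0 < (1 + a).re) (ζ : ℂ) {K : ℝ} (hK : 0 < K) :
    ∫ t : ℝ, Complex.exp (K * modelPhase a b c t ζ) =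
      (√(2 * Real.pi / K) : ℝ) * (1 + a) ^ (-(1 / 2) : ℂ) *
        Complex.exp (K * ((b - c ^ 2 / (1 + a)) * ζ ^ 2 - (‖ζ‖ : ℂ) ^ 2) / 2) := by
  have h : (-(K * (1 + a) / 2) : ℂ).re < 0 := by
    rw [Complex.neg_re, mul_div_assoc, Complex.re_ofReal_mul, Complex.div_ofNat_re, neg_lt_zero]
    positivity
  have ha0 : (1 + a) ≠ 0 := by intro h0; simp [h0] at ha
  have hK0 : (K : ℂ) ≠ 0 := by exact_mod_cast hK.ne'
  have e := integral_cexp_quadratic h (K * (Complex.I * c * ζ))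
    (K * ((b * ζ ^ 2 - (‖ζ‖ : ℂ) ^ 2) / 2))
  rw [show (fun t : ℝ => Complex.exp (K * modelPhase a b c t ζ)) = fun t : ℝ =>
    Complex.exp (-(K * (1 + a) / 2) * t ^ 2 + K * (Complex.I * c * ζ) * t +
      K * ((b * ζ ^ 2 - (‖ζ‖ : ℂ) ^ 2) / 2)) by
    funext t; rw [modelPhase_eq]; ring_nf, e]
  congr 1
  -- The principal root splits because one factor is a positive real, and it commutes with inversion
  -- because 1 + a lies off the negative axis.
  · have harg : (1 + a).arg ≠ Real.pi := by
      rw [Ne, Complex.arg_eq_pi_iff]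
      intro h; linarith [h.1]
    have e1 : (Real.pi / -(-(K * (1 + a) / 2)) : ℂ) =
        ((2 * Real.pi / K : ℝ) : ℂ) * (1 + a)⁻¹ := by
      push_cast; field_simp
    have hp : (0 : ℝ) < 2 * Real.pi / K := by positivity
    have e2 : (((2 * Real.pi / K : ℝ) : ℂ) * (1 + a)⁻¹) ^ (1 / 2 : ℂ) =
        ((2 * Real.pi / K : ℝ) : ℂ) ^ (1 / 2 : ℂ) * (1 + a)⁻¹ ^ (1 / 2 : ℂ) := by
      have hpc : ((2 * Real.pi / K : ℝ) : ℂ) ≠ 0 := Complex.ofReal_ne_zero.mpr hp.ne'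
      rw [Complex.cpow_def_of_ne_zero (mul_ne_zero hpc (inv_ne_zero ha0)),
        Complex.cpow_def_of_ne_zero hpc, Complex.cpow_def_of_ne_zero (inv_ne_zero ha0),
        Complex.log_ofReal_mul hp (inv_ne_zero ha0), Complex.ofReal_log hp.le,
        ← Complex.exp_add, add_mul]
    rw [e1, e2, Complex.inv_cpow _ _ harg, Complex.cpow_neg]
    congr 1
    rw [Real.sqrt_eq_rpow, Complex.ofReal_cpow hp.le]
    norm_num
  · congr 1
    field_simp
    rw [Complex.I_sq]
    ring

theorem gaussianSymbol_eq {a b c : ℂ} (ha : 0 < (1 + a).re) (ζ : ℂ) :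
    gaussianSymbol !![a, c; c, b] north (EuclideanSpace.single 1 ζ) =
            ((1 / √(2 * Real.pi) : ℝ) : ℂ) * (1 + a) ^ (-(1 / 2) : ℂ) *
              Complex.exp ((b - c ^ 2 / (1 + a)) * ζ ^ 2 / 2) *
              Complex.exp (-(‖ζ‖ : ℂ) ^ 2 / 2) := by
  have e := integral_exp_modelPhase (b := b) (c := c) ha ζ one_pos
  have h0 : (north : EuclideanSpace ℂ (Fin 2)) 0 = 1 := by simp [north]
  have h1 : (north : EuclideanSpace ℂ (Fin 2)) 1 = 0 := by simp [north]
  have hn : ‖(EuclideanSpace.single 1 ζ : EuclideanSpace ℂ (Fin 2))‖ = ‖ζ‖ := by simp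
  rw [gaussianSymbol, mul_assoc, ← integral_const_mul, hn]
  have e' : ∀ s : ℝ, Complex.exp (-(‖ζ‖ : ℂ) ^ 2 / 2) * (Complex.exp
        (quadForm !![a, c; c, b] ((Complex.I * s) • (north : EuclideanSpace ℂ (Fin 2)) +
          EuclideanSpace.single 1 ζ) / 2) * Complex.exp (-(s : ℂ) ^ 2 / 2)) =
      Complex.exp ((1 : ℝ) * modelPhase a b c s ζ) := by
    intro s
    rw [quadForm_two, ← Complex.exp_add, ← Complex.exp_add]
    simp only [PiLp.add_apply, PiLp.smul_apply, h0, h1, smul_eq_mul, modelPhase]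
    congr 1
    simp
    ring
  simp only [e']
  rw [e, mul_assoc _ (Complex.exp _) (Complex.exp _), ← Complex.exp_add, ← mul_assoc, ← mul_assoc]
  congr 1
  · congr 1
    have : (√(2 * Real.pi) : ℂ) * (√(2 * Real.pi) : ℂ) = 2 * Real.pi := by
      rw [← Complex.ofReal_mul, Real.mul_self_sqrt (by positivity)]; push_cast; rfl
    have hne : (√(2 * Real.pi) : ℂ) ≠ 0 := by
      rw [Complex.ofReal_ne_zero]; positivity
    rw [← this, div_one]
    push_cast
    field_simp
  · congr 1
    push_cast; ring

/-! ### Taylor expansion and decay of the phase. -/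

/-- Mean value inequality on a half-plane: it keeps the decay factor exp m even when x - y is large.
-/
theorem norm_exp_sub_exp_le {x y : ℂ} {m : ℝ} (hx : x.re ≤ m) (hy : y.re ≤ m) :
    ‖Complex.exp x - Complex.exp y‖ ≤ ‖x - y‖ * Real.exp m := by
  rw [mul_comm]
  refine Convex.norm_image_sub_le_of_norm_deriv_le (𝕜 := ℂ) (s := {w : ℂ | w.re ≤ m})
    (fun w _ => Complex.differentiableAt_exp) (fun w hw => ?_) (convex_halfSpace_re_le m) hy hx
  rw [Complex.deriv_exp, Complex.norm_exp]
  exact Real.exp_le_exp.mpr hw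

theorem norm_exp_I_mul_sub_taylor_le {t : ℝ} (ht : |t| ≤ Real.pi) :
    ‖Complex.exp (Complex.I * t) - 1‖ ≤ Real.exp Real.pi * |t| ∧
    ‖Complex.exp (Complex.I * t) - 1 - Complex.I * t‖ ≤ Real.exp Real.pi * |t| ^ 2 ∧
    ‖Complex.exp (Complex.I * t) - 1 - Complex.I * t + (t : ℂ) ^ 2 / 2‖ ≤
      Real.exp Real.pi * |t| ^ 3 := by
  have hn : ‖Complex.I * (t : ℂ)‖ = |t| := by simp
  have hexp : Real.exp |t| ≤ Real.exp Real.pi := Real.exp_le_exp.mpr ht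
  have key : ∀ n : ℕ, |t| ^ n * Real.exp |t| ≤ Real.exp Real.pi * |t| ^ n := by
    intro n; rw [mul_comm]; gcongr
  have h1 := Complex.norm_exp_sub_sum_le_norm_mul_exp (Complex.I * t) 1
  have h2 := Complex.norm_exp_sub_sum_le_norm_mul_exp (Complex.I * t) 2
  have h3 := Complex.norm_exp_sub_sum_le_norm_mul_exp (Complex.I * t) 3
  rw [hn] at h1 h2 h3
  have e1 : ∑ m ∈ Finset.range 1, (Complex.I * (t : ℂ)) ^ m / (m.factorial : ℂ) = 1 := by simp
  have e2 : ∑ m ∈ Finset.range 2, (Complex.I * (t : ℂ)) ^ m / (m.factorial : ℂ) =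
      1 + Complex.I * t := by
    simp [Finset.sum_range_succ]
  have e3 : ∑ m ∈ Finset.range 3, (Complex.I * (t : ℂ)) ^ m / (m.factorial : ℂ) =
      1 + Complex.I * t - (t : ℂ) ^ 2 / 2 := by
    simp [Finset.sum_range_succ, Nat.factorial, mul_pow]
    ring
  rw [e1] at h1
  rw [e2] at h2
  rw [e3] at h3
  refine ⟨by simpa using h1.trans (key 1), ?_, ?_⟩
  · rw [sub_sub]
    exact h2.trans (key 2)
  · rw [sub_sub, sub_add]
    exact h3.trans (key 3)

/-- With r = √(1 - |ζ|²) one has 1 - r = O(|ζ|²), so every term omitted from `modelPhase` is of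
third order in (t, ζ). The factor exp π absorbs the Taylor remainders on |t| ≤ π. -/
theorem norm_phase_sub_modelPhase_le (a b c : ℂ) {t r : ℝ} {ζ : ℂ} (ht : |t| ≤ Real.pi)
    (hr : 0 ≤ r) (hrζ : r ^ 2 + ‖ζ‖ ^ 2 = 1) :
    ‖phase a b c (Complex.exp (Complex.I * t) * r) (Complex.exp (Complex.I * t) * ζ) -
      Complex.I * t - modelPhase a b c t ζ‖ ≤
      Real.exp Real.pi ^ 2 * (‖a‖ + 2 * ‖c‖ + ‖b‖ + 3) * (|t| + ‖ζ‖) ^ 3 := by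
  obtain ⟨h1, h2, h3⟩ := norm_exp_I_mul_sub_taylor_le ht
  have hE : 1 ≤ Real.exp Real.pi := Real.one_le_exp Real.pi_pos.le
  have hne : ‖Complex.exp (Complex.I * t)‖ = 1 := norm_exp_I_mul_ofReal t
  set e := Complex.exp (Complex.I * t) with he
  set E := Real.exp Real.pi with hEdef
  set h := |t| + ‖ζ‖ with hh
  have hζ0 : 0 ≤ ‖ζ‖ := norm_nonneg ζ
  have ht0 : 0 ≤ |t| := abs_nonneg t
  have hh0 : 0 ≤ h := by positivity
  have hth : |t| ≤ h := by linarith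
  have hζh : ‖ζ‖ ≤ h := by linarith
  have hr1 : r ≤ 1 := by nlinarith [sq_nonneg ‖ζ‖]
  have hζ1 : ‖ζ‖ ≤ 1 := by nlinarith [sq_nonneg r]
  have h1r : ‖(r : ℂ) - 1‖ ≤ ‖ζ‖ ^ 2 := by
    rw [← Complex.ofReal_one, ← Complex.ofReal_sub, Complex.norm_real, Real.norm_eq_abs,
      abs_sub_comm, abs_of_nonneg (by linarith)]
    nlinarith
  have hsq : |t| ^ 2 + ‖ζ‖ ^ 2 ≤ h ^ 2 := by rw [hh]; nlinarith [mul_nonneg ht0 hζ0]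
  have hIt : ‖Complex.I * (t : ℂ)‖ = |t| := by simp
  set p := e * r - 1 with hp
  have hpt : ‖p - Complex.I * t‖ ≤ E * h ^ 2 := by
    calc ‖p - Complex.I * t‖ = ‖(e - 1 - Complex.I * t) + e * (r - 1)‖ := by rw [hp]; ring_nf
      _ ≤ E * |t| ^ 2 + 1 * ‖ζ‖ ^ 2 := by
        refine (norm_add_le _ _).trans (add_le_add h2 ?_)
        rw [norm_mul, hne]; gcongr
      _ ≤ E * |t| ^ 2 + E * ‖ζ‖ ^ 2 := by gcongr
      _ ≤ E * h ^ 2 := by rw [← mul_add]; gcongr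
  have hpn : ‖p‖ ≤ E * h := by
    calc ‖p‖ = ‖(e - 1) + e * (r - 1)‖ := by rw [hp]; ring_nf
      _ ≤ E * |t| + 1 * ‖ζ‖ ^ 2 := by
        refine (norm_add_le _ _).trans (add_le_add h1 ?_)
        rw [norm_mul, hne]; gcongr
      _ ≤ E * |t| + E * ‖ζ‖ := by
        gcongr
        nlinarith
      _ = E * h := by ring
  have hq : ‖e * ζ - ζ‖ ≤ E * h ^ 2 := by
    calc ‖e * ζ - ζ‖ = ‖e - 1‖ * ‖ζ‖ := by rw [← norm_mul]; ring_nf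
      _ ≤ E * |t| * ‖ζ‖ := by gcongr
      _ ≤ E * h * h := by gcongr
      _ = E * h ^ 2 := by ring
  have hqn : ‖e * ζ‖ = ‖ζ‖ := by rw [norm_mul, hne, one_mul]
  have A1 : ‖p ^ 2 - (Complex.I * t) ^ 2‖ ≤ 2 * E ^ 2 * h ^ 3 := by
    calc ‖p ^ 2 - (Complex.I * t) ^ 2‖ = ‖p - Complex.I * t‖ * ‖p + Complex.I * t‖ := by
          rw [← norm_mul]; ring_nf
      _ ≤ E * h ^ 2 * (E * h + E * h) := by
        gcongr
        refine (norm_add_le _ _).trans (add_le_add hpn ?_)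
        rw [hIt]; nlinarith
      _ = 2 * E ^ 2 * h ^ 3 := by ring
  have A2 : ‖p * (e * ζ) - Complex.I * t * ζ‖ ≤ 2 * E * h ^ 3 := by
    calc ‖p * (e * ζ) - Complex.I * t * ζ‖ =
          ‖(p - Complex.I * t) * (e * ζ) + Complex.I * t * (e * ζ - ζ)‖ := by ring_nf
      _ ≤ E * h ^ 2 * h + h * (E * h ^ 2) := by
        refine (norm_add_le _ _).trans (add_le_add ?_ ?_)
        · rw [norm_mul, hqn]; gcongr
        · rw [norm_mul, hIt]; gcongr
      _ = 2 * E * h ^ 3 := by ring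
  have A3 : ‖(e * ζ) ^ 2 - ζ ^ 2‖ ≤ 2 * E * h ^ 3 := by
    calc ‖(e * ζ) ^ 2 - ζ ^ 2‖ = ‖e * ζ - ζ‖ * ‖e * ζ + ζ‖ := by rw [← norm_mul]; ring_nf
      _ ≤ E * h ^ 2 * (h + h) := by
        gcongr
        refine (norm_add_le _ _).trans (add_le_add ?_ hζh)
        rw [hqn]; exact hζh
      _ = 2 * E * h ^ 3 := by ring
  -- Since |ζ|² = 1 - r², the term |ζ|²/2 equals -(r - 1) - (r - 1)²/2, which cancels the
  -- first-order part of r - 1.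
  have A4 : ‖e * r - 1 - Complex.I * t + (t : ℂ) ^ 2 / 2 + (‖ζ‖ : ℂ) ^ 2 / 2‖ ≤ 3 * E * h ^ 3 := by
    have hz : (‖ζ‖ : ℂ) ^ 2 = 1 - (r : ℂ) ^ 2 := by
      rw [← Complex.ofReal_pow, ← Complex.ofReal_pow, ← Complex.ofReal_one, ← Complex.ofReal_sub]
      congr 1; linarith
    calc ‖e * r - 1 - Complex.I * t + (t : ℂ) ^ 2 / 2 + (‖ζ‖ : ℂ) ^ 2 / 2‖ =
          ‖(e - 1 - Complex.I * t + (t : ℂ) ^ 2 / 2) + ((r - 1) * (e - 1) +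
            -((r - 1) * (r - 1) / 2))‖ := by
          rw [hz]; ring_nf
      _ ≤ E * |t| ^ 3 + (‖ζ‖ ^ 2 * (E * |t|) + ‖ζ‖ ^ 2 * ‖ζ‖ ^ 2) := by
        refine (norm_add_le _ _).trans (add_le_add h3 ((norm_add_le _ _).trans
          (add_le_add ?_ ?_)))
        · rw [norm_mul]; gcongr
        · rw [norm_neg, norm_div, norm_mul]
          have : ‖(r : ℂ) - 1‖ * ‖(r : ℂ) - 1‖ ≤ ‖ζ‖ ^ 2 * ‖ζ‖ ^ 2 := by gcongr
          simp only [Complex.norm_ofNat]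
          have h0 : 0 ≤ ‖(r : ℂ) - 1‖ * ‖(r : ℂ) - 1‖ := by positivity
          linarith
      _ ≤ E * h ^ 3 + (h ^ 2 * (E * h) + E * h ^ 3) := by
        have : ‖ζ‖ ^ 2 * ‖ζ‖ ^ 2 ≤ E * h ^ 3 := by
          calc ‖ζ‖ ^ 2 * ‖ζ‖ ^ 2 = ‖ζ‖ * ‖ζ‖ ^ 3 := by ring
            _ ≤ E * h ^ 3 := by gcongr; linarith
        refine add_le_add (by gcongr) (add_le_add (by gcongr) this)
      _ = 3 * E * h ^ 3 := by ring
  have hsplit : phase a b c (e * r) (e * ζ) - Complex.I * t - modelPhase a b c t ζ =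
      a / 2 * (p ^ 2 - (Complex.I * t) ^ 2) + c * (p * (e * ζ) - Complex.I * t * ζ) +
        b / 2 * ((e * ζ) ^ 2 - ζ ^ 2) +
        (e * r - 1 - Complex.I * t + (t : ℂ) ^ 2 / 2 + (‖ζ‖ : ℂ) ^ 2 / 2) := by
    rw [phase, modelPhase, hp]; ring
  rw [hsplit]
  have hh3 : 0 ≤ h ^ 3 := by positivity
  have hEE : E ≤ E ^ 2 := by nlinarith
  calc _ ≤ ‖a‖ / 2 * (2 * E ^ 2 * h ^ 3) + ‖c‖ * (2 * E * h ^ 3) + ‖b‖ / 2 * (2 * E * h ^ 3) +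
        3 * E * h ^ 3 := by
        refine (norm_add_le _ _).trans (add_le_add ((norm_add_le _ _).trans (add_le_add
          ((norm_add_le _ _).trans (add_le_add ?_ ?_)) ?_)) A4)
        · rw [norm_mul, norm_div, Complex.norm_ofNat]; gcongr
        · rw [norm_mul]; gcongr
        · rw [norm_mul, norm_div, Complex.norm_ofNat]; gcongr
    _ ≤ ‖a‖ / 2 * (2 * E ^ 2 * h ^ 3) + ‖c‖ * (2 * E ^ 2 * h ^ 3) + ‖b‖ / 2 * (2 * E ^ 2 * h ^ 3) +
        3 * E ^ 2 * h ^ 3 := by gcongr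
    _ = _ := by ring

theorem re_modelPhase_le {a b c : ℂ} {δ : ℝ} (h : ∀ x y : ℂ,
    (a * x ^ 2 + 2 * c * x * y + b * y ^ 2).re ≤ (1 - δ) * (‖x‖ ^ 2 + ‖y‖ ^ 2)) (t : ℝ) (ζ : ℂ) :
    (modelPhase a b c t ζ).re ≤ -(δ / 2) * (t ^ 2 + ‖ζ‖ ^ 2) := by
  have h1 := h (Complex.I * t) ζ
  have hn : ‖Complex.I * (t : ℂ)‖ ^ 2 = t ^ 2 := by simp
  rw [hn] at h1
  rw [modelPhase, Complex.sub_re, Complex.sub_re, Complex.div_ofNat_re, Complex.div_ofNat_re,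
    Complex.div_ofNat_re, ← Complex.ofReal_pow, ← Complex.ofReal_pow, Complex.ofReal_re,
    Complex.ofReal_re]
  linarith

/-- On the sphere |u - 1|² + |v|² = 2 - 2 Re u, so the linear term of the phase compensates the
quadratic bound and leaves -δ(1 - r cos t). -/
theorem re_phase_le {a b c : ℂ} {δ : ℝ} (hδ : 0 < δ) (h : ∀ x y : ℂ,
    (a * x ^ 2 + 2 * c * x * y + b * y ^ 2).re ≤ (1 - δ) * (‖x‖ ^ 2 + ‖y‖ ^ 2)) {t r : ℝ} {ζ : ℂ}
    (ht : |t| ≤ Real.pi) (hr : 0 ≤ r) (hrζ : r ^ 2 + ‖ζ‖ ^ 2 = 1) :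
    (phase a b c (Complex.exp (Complex.I * t) * r) (Complex.exp (Complex.I * t) * ζ)).re ≤
      -(δ / 50) * (t ^ 2 + ‖ζ‖ ^ 2) := by
  have h1 := h (Complex.exp (Complex.I * t) * r - 1) (Complex.exp (Complex.I * t) * ζ)
  have hn1 : ‖Complex.exp (Complex.I * t) * ζ‖ = ‖ζ‖ := by
    rw [norm_mul, norm_exp_I_mul_ofReal, one_mul]
  have hre : (Complex.exp (Complex.I * t) * r).re = Real.cos t * r := by
    rw [Complex.re_mul_ofReal, mul_comm Complex.I, Complex.exp_ofReal_mul_I_re]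
  have him : (Complex.exp (Complex.I * t) * r).im = Real.sin t * r := by
    rw [Complex.im_mul_ofReal, mul_comm Complex.I, Complex.exp_ofReal_mul_I_im]
  have hn2 : ‖Complex.exp (Complex.I * t) * r - 1‖ ^ 2 = r ^ 2 - 2 * r * Real.cos t + 1 := by
    rw [← Complex.normSq_eq_norm_sq, Complex.normSq_apply, Complex.sub_re, Complex.sub_im, hre, him,
      Complex.one_re, Complex.one_im]
    linear_combination r ^ 2 * Real.sin_sq_add_cos_sq t
  rw [hn1, hn2] at h1
  have e : (phase a b c (Complex.exp (Complex.I * t) * r) (Complex.exp (Complex.I * t) * ζ)).re ≤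
      -(δ / 2) * (2 - 2 * r * Real.cos t) := by
    rw [phase, Complex.sub_re, Complex.add_re, hre, Complex.one_re, Complex.div_ofNat_re]
    have : r ^ 2 - 2 * r * Real.cos t + 1 + ‖ζ‖ ^ 2 = 2 - 2 * r * Real.cos t := by linarith
    rw [this] at h1
    linarith
  refine e.trans ?_
  have hr1 : r ≤ 1 := by nlinarith [sq_nonneg ‖ζ‖]
  have hcos : Real.cos t ≤ 1 - 2 / Real.pi ^ 2 * t ^ 2 := Real.cos_le_one_sub_mul_cos_sq ht
  have hpi2 : Real.pi ^ 2 ≤ 10 := by nlinarith [Real.pi_lt_d2, Real.pi_pos]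
  have ht2 : t ^ 2 ≤ 10 := by
    rw [← sq_abs]; nlinarith [abs_nonneg t]
  have hinv : 1 / 5 ≤ 2 / Real.pi ^ 2 := by
    rw [div_le_div_iff₀ (by norm_num) (by positivity)]; linarith
  have hcos' : Real.cos t ≤ 1 - 1 / 5 * t ^ 2 := by nlinarith [sq_nonneg t]
  have hrc : r * Real.cos t ≤ r * (1 - 1 / 5 * t ^ 2) := by gcongr
  have hrz : 1 - ‖ζ‖ ^ 2 ≤ r := by nlinarith
  -- For r near 1 the term r t² controls t²; for small r, 2 - 2r is bounded below while t² ≤ 10.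
  have hkey : 1 / 25 * (t ^ 2 + ‖ζ‖ ^ 2) ≤ 2 - 2 * r * Real.cos t := by
    nlinarith [sq_nonneg (1 - r), mul_nonneg (sq_nonneg t) hr, sq_nonneg t, sq_nonneg ‖ζ‖]
  nlinarith

/-- In the scaled variable u = √K (t + s) the prefactor is u³/√K; half of the exponential absorbs
u³, and the other half remains as the Gaussian bound. -/
theorem cube_mul_exp_le {κ : ℝ} (hκ : 0 < κ) {K t s : ℝ} (hK : 0 < K) (ht : 0 ≤ t) (hs : 0 ≤ s) :
    K * (t + s) ^ 3 * Real.exp (-(2 * κ) * K * (t ^ 2 + s ^ 2)) ≤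
      (1 + 8 / κ ^ 2) / √K * (Real.exp (-κ * K * s ^ 2) * Real.exp (-(κ * K) * t ^ 2)) := by
  have hsK : 0 < √K := Real.sqrt_pos.mpr hK
  have hKK : √K ^ 2 = K := Real.sq_sqrt hK.le
  set T : ℝ := K * (t ^ 2 + s ^ 2) with hT
  have hT0 : 0 ≤ T := by positivity
  set u : ℝ := √K * (t + s) with hu
  have hu0 : 0 ≤ u := by positivity
  have hu2 : u ^ 2 ≤ 2 * T := by
    rw [hu, mul_pow, hKK, hT]
    nlinarith [mul_nonneg hK.le (sq_nonneg (t - s))]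
  have hu3 : u ^ 3 ≤ 1 + 4 * T ^ 2 := by
    have h4 : u ^ 4 ≤ 4 * T ^ 2 := by nlinarith [sq_nonneg u]
    rcases le_total u 1 with h1 | h1
    · have : u ^ 3 ≤ 1 := pow_le_one₀ hu0 h1
      nlinarith [sq_nonneg T]
    · have : u ^ 3 ≤ u ^ 4 := pow_le_pow_right₀ h1 (by norm_num)
      linarith
  have hq := Real.quadratic_le_exp_of_nonneg (mul_nonneg hκ.le hT0)
  have h5 : 1 + 4 * T ^ 2 ≤ (1 + 8 / κ ^ 2) * Real.exp (κ * T) := by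
    have h6 : 4 * T ^ 2 = 8 / κ ^ 2 * ((κ * T) ^ 2 / 2) := by field_simp; ring
    have h7 : (κ * T) ^ 2 / 2 ≤ Real.exp (κ * T) := by nlinarith [mul_nonneg hκ.le hT0]
    have h8 : 1 ≤ Real.exp (κ * T) := Real.one_le_exp (by positivity)
    rw [h6, add_mul, one_mul]
    gcongr
  have e1 : K * (t + s) ^ 3 = u ^ 3 / √K := by
    rw [hu, mul_pow, eq_div_iff hsK.ne']
    calc K * (t + s) ^ 3 * √K = √K ^ 2 * (t + s) ^ 3 * √K := by rw [hKK]
      _ = _ := by ring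
  have e2 : Real.exp (-κ * K * s ^ 2) * Real.exp (-(κ * K) * t ^ 2) =
      Real.exp (κ * T) * Real.exp (-(2 * κ) * K * (t ^ 2 + s ^ 2)) := by
    rw [← Real.exp_add, ← Real.exp_add, hT]; ring_nf
  rw [e1, e2, div_mul_eq_mul_div, div_mul_eq_mul_div, ← mul_assoc]
  gcongr
  exact hu3.trans h5

/-! ### Laplace approximation. -/

theorem reducedInt_eq_integral_neg_pi_pi (k : ℕ) (a b c x y : ℂ) :
    reducedInt k a b c x y = 1 / (2 * (Real.pi : ℂ)) * ∫ t in Set.Ioc (-Real.pi) Real.pi,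
      Complex.exp (k * (phase a b c (Complex.exp (Complex.I * t) * x)
        (Complex.exp (Complex.I * t) * y) - Complex.I * t)) := by
  have h := (periodic_reducedInt_integrand k a b c x y).intervalIntegral_add_eq 0 (-Real.pi)
  rw [zero_add, show -Real.pi + 2 * Real.pi = Real.pi by ring] at h
  rw [reducedInt, h, intervalIntegral.integral_of_le (by linarith [Real.pi_pos])]
  congr 2
  funext t
  rw [← Complex.exp_add]
  ring_nf

theorem continuous_phase_exp (a b c x y : ℂ) : Continuous fun t : ℝ =>
    phase a b c (Complex.exp (Complex.I * t) * x) (Complex.exp (Complex.I * t) * y) := by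
  unfold phase; fun_prop

/-- Laplace approximation of the reduced Gaussian state near the orbit of `(1, 0)`. -/
theorem exists_norm_reducedInt_sub_le {a b c : ℂ} {δ : ℝ} (hδ : 0 < δ) (h : ∀ x y : ℂ,
    (a * x ^ 2 + 2 * c * x * y + b * y ^ 2).re ≤ (1 - δ) * (‖x‖ ^ 2 + ‖y‖ ^ 2)) :
    ∃ C : ℝ, 0 ≤ C ∧ ∀ k : ℕ, 1 ≤ k → ∀ (r : ℝ) (ζ : ℂ), 0 ≤ r → r ^ 2 + ‖ζ‖ ^ 2 = 1 →
      ‖reducedInt k a b c r ζ - 1 / (2 * (Real.pi : ℂ)) *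
          ∫ t : ℝ, Complex.exp ((k : ℝ) * modelPhase a b c t ζ)‖ ≤
        C / k * Real.exp (-(δ / 100) * k * ‖ζ‖ ^ 2) := by
  have hα := re_one_add_pos hδ h
  set M : ℝ := Real.exp Real.pi ^ 2 * (‖a‖ + 2 * ‖c‖ + ‖b‖ + 3) with hM
  have hM1 : 1 ≤ M := by
    have hE : 1 ≤ Real.exp Real.pi ^ 2 := one_le_pow₀ (Real.one_le_exp Real.pi_pos.le)
    nlinarith [norm_nonneg a, norm_nonneg b, norm_nonneg c]
  -- Half of the decay rate δ/50 from `re_phase_le`; the other half is spent in `cube_mul_exp_le`.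
  set κ : ℝ := δ / 100 with hκ
  have hκ0 : 0 < κ := by positivity
  set D : ℝ := M * (1 + 8 / κ ^ 2) with hD
  have hD0 : 0 ≤ D := by positivity
  refine ⟨D * √(Real.pi / κ), by positivity, fun k hk r ζ hr hrζ => ?_⟩
  have hkpos : (0 : ℝ) < k := by exact_mod_cast hk
  have hk1 : (1 : ℝ) ≤ k := by exact_mod_cast hk
  set F : ℝ → ℂ := fun t => Complex.exp (k * (phase a b c (Complex.exp (Complex.I * t) * r)
    (Complex.exp (Complex.I * t) * ζ) - Complex.I * t)) with hF
  set G : ℝ → ℂ := fun t => Complex.exp ((k : ℝ) * modelPhase a b c t ζ) with hG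
  set I : Set ℝ := Set.Ioc (-Real.pi) Real.pi with hI
  have hFc : Continuous F := by
    have := continuous_phase_exp a b c r ζ
    simp only [hF]; fun_prop
  have hFi : Integrable (I.indicator F) := by
    rw [integrable_indicator_iff measurableSet_Ioc]
    exact (hFc.integrableOn_Icc (a := -Real.pi) (b := Real.pi)).mono_set Set.Ioc_subset_Icc_self
  have hGi : Integrable G := integrable_exp_modelPhase hα ζ hkpos
  have hYre : ∀ t : ℝ, ((k : ℂ) * modelPhase a b c t ζ).re ≤
      -(2 * κ) * k * (|t| ^ 2 + ‖ζ‖ ^ 2) := by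
    intro t
    rw [← Complex.ofReal_natCast, Complex.re_ofReal_mul, sq_abs]
    have h1 := re_modelPhase_le h t ζ
    have h2 : 0 ≤ t ^ 2 + ‖ζ‖ ^ 2 := by positivity
    calc (k : ℝ) * (modelPhase a b c t ζ).re ≤ k * (-(δ / 2) * (t ^ 2 + ‖ζ‖ ^ 2)) := by gcongr
      _ ≤ k * (-(2 * κ) * (t ^ 2 + ‖ζ‖ ^ 2)) := by gcongr; rw [hκ]; linarith
      _ = _ := by ring
  have hcube : ∀ t : ℝ, M * (k * (|t| + ‖ζ‖) ^ 3 *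
      Real.exp (-(2 * κ) * k * (|t| ^ 2 + ‖ζ‖ ^ 2))) ≤
      D / √k * Real.exp (-κ * k * ‖ζ‖ ^ 2) * Real.exp (-(κ * k) * t ^ 2) := by
    intro t
    have := cube_mul_exp_le hκ0 hkpos (abs_nonneg t) (norm_nonneg ζ)
    calc _ ≤ M * ((1 + 8 / κ ^ 2) / √k * (Real.exp (-κ * k * ‖ζ‖ ^ 2) *
          Real.exp (-(κ * k) * |t| ^ 2))) := by gcongr
      _ = _ := by rw [sq_abs, hD]; ring
  have hpt : ∀ t : ℝ, ‖I.indicator F t - G t‖ ≤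
      D / √k * Real.exp (-κ * k * ‖ζ‖ ^ 2) * Real.exp (-(κ * k) * t ^ 2) := by
    intro t
    refine le_trans ?_ (hcube t)
    by_cases ht : t ∈ I
    · rw [Set.indicator_of_mem ht]
      have ht' : |t| ≤ Real.pi := abs_le.mpr ⟨ht.1.le, ht.2⟩
      have hXre : ((k : ℂ) * (phase a b c (Complex.exp (Complex.I * t) * r)
          (Complex.exp (Complex.I * t) * ζ) - Complex.I * t)).re ≤
          -(2 * κ) * k * (|t| ^ 2 + ‖ζ‖ ^ 2) := by
        rw [← Complex.ofReal_natCast, Complex.re_ofReal_mul, sq_abs, Complex.sub_re,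
          Complex.re_mul_ofReal, Complex.I_re, zero_mul, sub_zero]
        have h1 := re_phase_le hδ h ht' hr hrζ
        calc _ ≤ (k : ℝ) * (-(δ / 50) * (t ^ 2 + ‖ζ‖ ^ 2)) := by gcongr
          _ = _ := by rw [hκ]; ring
      refine (norm_exp_sub_exp_le hXre (hYre t)).trans ?_
      rw [← mul_sub, norm_mul, Complex.norm_natCast]
      have h2 := norm_phase_sub_modelPhase_le a b c ht' hr hrζ
      calc _ ≤ (k : ℝ) * (M * (|t| + ‖ζ‖) ^ 3) *
          Real.exp (-(2 * κ) * k * (|t| ^ 2 + ‖ζ‖ ^ 2)) := by gcongr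
        _ = _ := by ring
    -- Outside the period only the model tail is left. There |t| ≥ 1, so the cubic prefactor is at
    -- least 1 and the same bound covers it.
    · rw [Set.indicator_of_notMem ht, zero_sub, norm_neg, hG]
      simp only [Complex.norm_exp, Complex.ofReal_natCast]
      have ht1 : 1 ≤ |t| := by
        by_contra! hcon
        apply ht
        have := abs_lt.mp hcon
        have hp := Real.two_le_pi
        exact ⟨by linarith [this.1], by linarith [this.2]⟩
      have h3 : 1 ≤ M * (k * (|t| + ‖ζ‖) ^ 3) := by
        have : 1 ≤ (|t| + ‖ζ‖) ^ 3 := one_le_pow₀ (by linarith [norm_nonneg ζ])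
        exact one_le_mul_of_one_le_of_one_le hM1 (one_le_mul_of_one_le_of_one_le hk1 this)
      rw [← mul_assoc]
      refine (Real.exp_le_exp.mpr (hYre t)).trans ?_
      exact le_mul_of_one_le_left (Real.exp_nonneg _) h3
  have hgi : Integrable fun t : ℝ => D / √k * Real.exp (-κ * k * ‖ζ‖ ^ 2) *
      Real.exp (-(κ * k) * t ^ 2) := (integrable_exp_neg_mul_sq (by positivity)).const_mul _
  have hle := norm_integral_le_of_norm_le hgi (Filter.Eventually.of_forall hpt)
  rw [integral_sub hFi hGi, integral_indicator measurableSet_Ioc, integral_const_mul,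
    integral_gaussian] at hle
  rw [reducedInt_eq_integral_neg_pi_pi, ← mul_sub, norm_mul]
  have hpi : ‖1 / (2 * (Real.pi : ℂ))‖ ≤ 1 := by
    rw [norm_div, norm_mul, Complex.norm_real, Real.norm_of_nonneg Real.pi_pos.le]
    simp only [norm_one, Complex.norm_ofNat]
    rw [div_le_one (by positivity)]
    linarith [Real.two_le_pi]
  -- Integrating the Gaussian in t gives the second factor k^(-1/2), hence the rate 1/k.
  calc _ ≤ 1 * (D / √k * Real.exp (-κ * k * ‖ζ‖ ^ 2) * √(Real.pi / (κ * k))) := by gcongr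
    _ = _ := by
      rw [← div_div, Real.sqrt_div (by positivity) (k : ℝ), one_mul]
      have : (k : ℝ) = √k * √k := (Real.mul_self_sqrt hkpos.le).symm
      have hs : 0 < √(k : ℝ) := Real.sqrt_pos.mpr hkpos
      generalize Real.exp (-κ * k * ‖ζ‖ ^ 2) = X
      rw [show D * √(Real.pi / κ) / k * X = D * √(Real.pi / κ) / (√k * √k) * X by rw [← this]]
      field_simp

/-- Both states have the same weight, so a single rotation makes the first coordinate nonnegative
for both. -/
theorem norm_reducedInt_sub_rotate (k : ℕ) (a b c μ s x y : ℂ) :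
    ∃ ζ : ℂ, ‖ζ‖ = ‖y‖ ∧ ‖reducedInt k a b c x y - s * reducedInt k 0 μ 0 x y‖ =
      ‖reducedInt k a b c (‖x‖ : ℝ) ζ - s * reducedInt k 0 μ 0 (‖x‖ : ℝ) ζ‖ := by
  have h1 : ‖Complex.exp (Complex.I * ((-x.arg : ℝ) : ℂ))‖ = 1 := norm_exp_I_mul_ofReal _
  refine ⟨Complex.exp (Complex.I * ((-x.arg : ℝ) : ℂ)) * y, by rw [norm_mul, h1, one_mul], ?_⟩
  have hx : ((‖x‖ : ℝ) : ℂ) = Complex.exp (Complex.I * ((-x.arg : ℝ) : ℂ)) * x := by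
    nth_rewrite 3 [← Complex.norm_mul_exp_arg_mul_I x]
    rw [mul_left_comm, ← Complex.exp_add]
    push_cast
    rw [show Complex.I * -(x.arg : ℂ) + x.arg * Complex.I = 0 by ring]
    simp
  have h2 : ‖Complex.exp (Complex.I * k * ((-x.arg : ℝ) : ℂ))‖ = 1 := by
    rw [show Complex.I * k * ((-x.arg : ℝ) : ℂ) = Complex.I * ((k * -x.arg : ℝ) : ℂ) by
      push_cast; ring]
    exact norm_exp_I_mul_ofReal _
  rw [hx, reducedInt_rotate, reducedInt_rotate, mul_left_comm, ← mul_sub, norm_mul, h2, one_mul]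

/-- The two Laplace approximations have proportional main terms, with ratio (1 + a)^(-1/2), so these
cancel and only the errors remain. -/
theorem exists_norm_reducedInt_sub_reducedInt_le {a b c : ℂ} {δ : ℝ} (hδ : 0 < δ)
    (h : ∀ x y : ℂ,
      (a * x ^ 2 + 2 * c * x * y + b * y ^ 2).re ≤ (1 - δ) * (‖x‖ ^ 2 + ‖y‖ ^ 2)) :
    ∃ C κ : ℝ, 0 ≤ C ∧ 0 < κ ∧ ∀ k : ℕ, 1 ≤ k → ∀ x y : ℂ, ‖x‖ ^ 2 + ‖y‖ ^ 2 = 1 →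
      ‖reducedInt k a b c x y -
          (1 + a) ^ (-(1 / 2) : ℂ) * reducedInt k 0 (b - c ^ 2 / (1 + a)) 0 x y‖ ≤
        C / k * Real.exp (-κ * k * ‖y‖ ^ 2) := by
  set μ := b - c ^ 2 / (1 + a) with hμdef
  have hα := re_one_add_pos hδ h
  have hμ : ‖μ‖ < 1 := norm_schur_lt_one hδ h
  have hδ' : 0 < 1 - ‖μ‖ := by linarith
  obtain ⟨C₁, hC₁, H₁⟩ := exists_norm_reducedInt_sub_le hδ h
  obtain ⟨C₂, hC₂, H₂⟩ := exists_norm_reducedInt_sub_le hδ' (re_diag_le μ)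
  set s : ℂ := (1 + a) ^ (-(1 / 2) : ℂ) with hs
  set κ := min (δ / 100) ((1 - ‖μ‖) / 100) with hκ
  refine ⟨C₁ + ‖s‖ * C₂, κ, by positivity, by positivity, fun k hk x y hxy => ?_⟩
  obtain ⟨ζ, hζ, e⟩ := norm_reducedInt_sub_rotate k a b c μ s x y
  rw [e, ← hζ]
  rw [← hζ] at hxy
  have hkpos : (0 : ℝ) < k := by exact_mod_cast hk
  have h1 := H₁ k hk ‖x‖ ζ (norm_nonneg x) hxy
  have h2 := H₂ k hk ‖x‖ ζ (norm_nonneg x) hxy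
  have hmodel : ∫ t : ℝ, Complex.exp ((k : ℝ) * modelPhase a b c t ζ) =
      s * ∫ t : ℝ, Complex.exp ((k : ℝ) * modelPhase 0 μ 0 t ζ) := by
    rw [integral_exp_modelPhase hα ζ hkpos, integral_exp_modelPhase (by simp) ζ hkpos]
    simp only [add_zero, Complex.one_cpow, ← hμdef]
    norm_num
    ring
  rw [hmodel] at h1
  have hsplit : reducedInt k a b c (‖x‖ : ℝ) ζ - s * reducedInt k 0 μ 0 (‖x‖ : ℝ) ζ =
      (reducedInt k a b c (‖x‖ : ℝ) ζ - 1 / (2 * (Real.pi : ℂ)) *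
        (s * ∫ t : ℝ, Complex.exp ((k : ℝ) * modelPhase 0 μ 0 t ζ))) -
      s * (reducedInt k 0 μ 0 (‖x‖ : ℝ) ζ - 1 / (2 * (Real.pi : ℂ)) *
        ∫ t : ℝ, Complex.exp ((k : ℝ) * modelPhase 0 μ 0 t ζ)) := by ring
  rw [hsplit]
  calc _ ≤ C₁ / k * Real.exp (-(δ / 100) * k * ‖ζ‖ ^ 2) +
        ‖s‖ * (C₂ / k * Real.exp (-((1 - ‖μ‖) / 100) * k * ‖ζ‖ ^ 2)) := by
        refine (norm_sub_le _ _).trans (add_le_add h1 ?_)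
        rw [norm_mul]
        gcongr
    _ ≤ C₁ / k * Real.exp (-κ * k * ‖ζ‖ ^ 2) +
        ‖s‖ * (C₂ / k * Real.exp (-κ * k * ‖ζ‖ ^ 2)) := by
        gcongr
        · exact min_le_left _ _
        · exact min_le_right _ _
    _ = _ := by ring

/-! ### Pointwise lower bound for the reference state. -/

/-- The Stirling sequence decreases from its value e/√2 at 1, hence k! ≤ e √k (k/e)^k. -/
theorem one_div_le_exp_neg_mul_pow_div_factorial {k : ℕ} (hk : 1 ≤ k) :
    1 / (Real.exp 1 * √k) ≤ Real.exp (-k) * ((k : ℝ) ^ k / k.factorial) := by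
  have hkpos : (0 : ℝ) < k := by exact_mod_cast hk
  have hle : Stirling.stirlingSeq k ≤ Stirling.stirlingSeq 1 := by
    have := Stirling.stirlingSeq'_antitone (Nat.zero_le (k - 1))
    simpa [Nat.succ_eq_add_one, Nat.sub_add_cancel hk] using this
  rw [Stirling.stirlingSeq_one, Stirling.stirlingSeq, div_le_div_iff₀ (by positivity)
    (by positivity), Real.sqrt_mul (by norm_num), div_pow, Real.exp_one_pow] at hle
  have h2 : (0 : ℝ) < √2 := by positivity
  have hle' : (k.factorial : ℝ) ≤ Real.exp 1 * (√k * ((k : ℝ) ^ k / Real.exp k)) := by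
    have : (k.factorial : ℝ) * √2 ≤ (Real.exp 1 * (√k * ((k : ℝ) ^ k / Real.exp k))) * √2 :=
      hle.trans (le_of_eq (by ring))
    exact le_of_mul_le_mul_right this h2
  have hf : (0 : ℝ) < k.factorial := by exact_mod_cast k.factorial_pos
  rw [Real.exp_neg, div_le_iff₀ (by positivity), ← div_eq_inv_mul, div_div,
    div_mul_eq_mul_div, le_div_iff₀ (by positivity), one_mul]
  rw [← mul_div_assoc, ← mul_div_assoc, le_div_iff₀ (by positivity)] at hle'
  linarith

theorem sum_range_quarter_pow_le (n : ℕ) : ∑ l ∈ Finset.range n, (1 / 4 : ℝ) ^ (l + 1) ≤ 1 / 2 := by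
  have : ∑ l ∈ Finset.range n, (1 / 4 : ℝ) ^ (l + 1) = 1 / 3 * (1 - (1 / 4) ^ n) := by
    induction n with
    | zero => simp
    | succ n ih => rw [Finset.sum_range_succ, ih]; ring
  rw [this]
  have h0 : (0 : ℝ) ≤ (1 / 4) ^ n := by positivity
  linarith

/-- Near y = 0 the ℓ-th term is at most 4^(-ℓ) times the term ℓ = 0, so at least half of the latter
survives. The constant is 1/2 · 3/4 · 1/e, with 3/4 from Bernoulli's inequality for |x|^k. -/
theorem le_norm_reducedInt_diag {μ : ℂ} (hμ : ‖μ‖ < 1) {k : ℕ} (hk : 1 ≤ k) {x y : ℂ}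
    (hxy : ‖x‖ ^ 2 + ‖y‖ ^ 2 = 1) (hy : ‖y‖ ^ 2 ≤ 1 / (4 * k)) :
    3 / (8 * Real.exp 1) / √k ≤ ‖reducedInt k 0 μ 0 x y‖ := by
  have hkpos : (0 : ℝ) < k := by exact_mod_cast hk
  have hk1 : (1 : ℝ) ≤ k := by exact_mod_cast hk
  have hky : k * ‖y‖ ^ 2 ≤ 1 / 4 := by
    rw [le_div_iff₀ (by positivity)] at hy; linarith
  have hx2 : 1 / 2 ≤ ‖x‖ ^ 2 := by nlinarith [sq_nonneg ‖y‖]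
  have hx0 : 0 < ‖x‖ := by
    rcases (norm_nonneg x).eq_or_lt with h0 | h0
    · rw [← h0] at hx2; norm_num at hx2
    · exact h0
  have hx1 : ‖x‖ ≤ 1 := by nlinarith [sq_nonneg ‖y‖]
  set A : ℝ := ((k : ℝ) * ‖x‖) ^ k / k.factorial with hA
  have hA0 : 0 ≤ A := by positivity
  have hterm : ∀ l, 2 * l ≤ k →
      ‖(k * μ * y ^ 2 / 2) ^ l / (l.factorial : ℂ) *
          ((k * x) ^ (k - 2 * l) / ((k - 2 * l).factorial : ℂ))‖ ≤ A * (1 / 4) ^ l := by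
    intro l hl
    simp only [norm_mul, norm_div, norm_pow, Complex.norm_natCast, Complex.norm_ofNat]
    have h1 : (k * ‖μ‖ * ‖y‖ ^ 2 / 2) ^ l / (l.factorial : ℝ) ≤
        (1 / 4 * ‖x‖ ^ 2) ^ l := by
      have hf : (1 : ℝ) ≤ l.factorial := by exact_mod_cast l.factorial_pos
      refine (div_le_self (by positivity) hf).trans ?_
      gcongr
      have : k * ‖μ‖ * ‖y‖ ^ 2 ≤ k * ‖y‖ ^ 2 := by
        have h3 : 0 ≤ k * ‖y‖ ^ 2 := by positivity
        nlinarith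
      linarith
    have h2 : (1 : ℝ) / ((k - 2 * l).factorial : ℝ) ≤ (k : ℝ) ^ (2 * l) / k.factorial := by
      rw [div_le_div_iff₀ (by positivity) (by positivity), one_mul, mul_comm]
      have h3 : k.factorial ≤ (k - 2 * l).factorial * k ^ (2 * l) := by
        rw [← Nat.factorial_mul_descFactorial hl]
        gcongr
        exact Nat.descFactorial_le_pow k (2 * l)
      exact_mod_cast h3
    have hkk : (k : ℝ) ^ k = (k : ℝ) ^ (k - 2 * l) * (k : ℝ) ^ (2 * l) := by
      rw [← pow_add]; congr 1; omega
    have hxx : ‖x‖ ^ k = ‖x‖ ^ (k - 2 * l) * ‖x‖ ^ (2 * l) := by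
      rw [← pow_add]; congr 1; omega
    calc _ ≤ (1 / 4 * ‖x‖ ^ 2) ^ l * ((k * ‖x‖) ^ (k - 2 * l) *
          ((k : ℝ) ^ (2 * l) / k.factorial)) := by
          rw [div_eq_mul_one_div ((k * ‖x‖) ^ (k - 2 * l))]
          gcongr
      _ = A * (1 / 4) ^ l := by
          rw [hA, mul_pow (k : ℝ) ‖x‖ k, hkk, hxx, mul_pow, mul_pow, ← pow_mul]
          ring
  have hxk : 3 / 4 ≤ ‖x‖ ^ k := by
    have hb := one_add_mul_le_pow (a := -(1 / (4 * (k : ℝ)))) (by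
      have : 1 / (4 * (k : ℝ)) ≤ 1 := by
        rw [div_le_one (by positivity)]; linarith
      linarith) k
    have e : 1 + (k : ℝ) * -(1 / (4 * (k : ℝ))) = 3 / 4 := by field_simp; norm_num
    rw [e] at hb
    calc (3 : ℝ) / 4 ≤ (1 + -(1 / (4 * (k : ℝ)))) ^ k := hb
      _ ≤ (‖x‖ ^ 2) ^ k := by
        refine pow_le_pow_left₀ ?_ (by linarith) k
        have : 1 / (4 * (k : ℝ)) ≤ 1 := by
          rw [div_le_one (by positivity)]; linarith
        linarith
      _ = (‖x‖ ^ k) ^ 2 := by ring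
      _ ≤ ‖x‖ ^ k := by
        have h1 : ‖x‖ ^ k ≤ 1 := pow_le_one₀ hx0.le hx1
        have h0 : 0 ≤ ‖x‖ ^ k := by positivity
        nlinarith
  have hsum : A / 2 ≤ ‖∑ l ∈ Finset.range (k / 2 + 1), (k * μ * y ^ 2 / 2) ^ l / (l.factorial : ℂ) *
          ((k * x) ^ (k - 2 * l) / ((k - 2 * l).factorial : ℂ))‖ := by
    rw [Finset.sum_range_succ']
    have h0 : ‖(k * μ * y ^ 2 / 2) ^ 0 / (Nat.factorial 0 : ℂ) *
          ((k * x) ^ (k - 2 * 0) / ((k - 2 * 0).factorial : ℂ))‖ = A := by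
      simp [hA]
    have h1 : ‖∑ l ∈ Finset.range (k / 2),
        (k * μ * y ^ 2 / 2) ^ (l + 1) / ((l + 1).factorial : ℂ) *
          ((k * x) ^ (k - 2 * (l + 1)) / ((k - 2 * (l + 1)).factorial : ℂ))‖ ≤ A / 2 := by
      calc _ ≤ ∑ l ∈ Finset.range (k / 2), A * (1 / 4) ^ (l + 1) := by
            refine norm_sum_le_of_le _ fun l hl => hterm (l + 1) ?_
            rw [Finset.mem_range] at hl; omega
        _ = A * ∑ l ∈ Finset.range (k / 2), (1 / 4 : ℝ) ^ (l + 1) := by rw [Finset.mul_sum]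
        _ ≤ A * (1 / 2) := by gcongr; exact sum_range_quarter_pow_le _
        _ = A / 2 := by ring
    have h2 := norm_sub_le_norm_add
      ((k * μ * y ^ 2 / 2) ^ 0 / (Nat.factorial 0 : ℂ) *
          ((k * x) ^ (k - 2 * 0) / ((k - 2 * 0).factorial : ℂ)))
      (∑ l ∈ Finset.range (k / 2),
        (k * μ * y ^ 2 / 2) ^ (l + 1) / ((l + 1).factorial : ℂ) *
          ((k * x) ^ (k - 2 * (l + 1)) / ((k - 2 * (l + 1)).factorial : ℂ)))
    rw [h0, add_comm] at h2
    linarith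
  rw [reducedInt_diag, norm_mul, Complex.norm_exp, Complex.neg_re, Complex.natCast_re]
  have hS := one_div_le_exp_neg_mul_pow_div_factorial hk
  calc 3 / (8 * Real.exp 1) / √k = 3 / 8 * (1 / (Real.exp 1 * √k)) := by
        field_simp
    _ ≤ 3 / 8 * (Real.exp (-k) * ((k : ℝ) ^ k / k.factorial)) := by gcongr
    _ = Real.exp (-k) * ((k : ℝ) ^ k / k.factorial * (3 / 4) / 2) := by ring
    _ ≤ Real.exp (-k) * ((k : ℝ) ^ k / k.factorial * ‖x‖ ^ k / 2) := by gcongr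
    _ = Real.exp (-k) * (A / 2) := by rw [hA, mul_pow]; ring
    _ ≤ _ := by gcongr

/-! ### Gaussian integrals and thin tubes on the three-sphere. -/

/-- The coordinates of `ℂ²`. -/
noncomputable def coords : EuclideanSpace ℂ (Fin 2) ≃L[ℂ] ℂ × ℂ :=
  (EuclideanSpace.equiv (Fin 2) ℂ).trans (ContinuousLinearEquiv.finTwoArrow ℂ ℂ)

theorem coords_apply (z : EuclideanSpace ℂ (Fin 2)) : coords z = (z 0, z 1) := rfl

/-- Uniqueness of Haar measure; the value of m is irrelevant, as both surface estimates need only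
some constant. -/
theorem exists_map_coords_volume : ∃ m : ℝ, 0 < m ∧
    Measure.map coords (volume : Measure (EuclideanSpace ℂ (Fin 2))) =
      ENNReal.ofReal m • (volume : Measure (ℂ × ℂ)) := by
  have : (Measure.map coords (volume : Measure (EuclideanSpace ℂ (Fin 2)))).IsAddHaarMeasure :=
    coords.isAddHaarMeasure_map _
  have hprod : (volume : Measure (ℂ × ℂ)).IsAddHaarMeasure :=
    Measure.prod.instIsAddHaarMeasure volume volume
  have h := Measure.isAddLeftInvariant_eq_smul
    (Measure.map coords (volume : Measure (EuclideanSpace ℂ (Fin 2))))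
    (volume : Measure (ℂ × ℂ))
  have hpos := Measure.addHaarScalarFactor_pos_of_isAddHaarMeasure
    (Measure.map coords (volume : Measure (EuclideanSpace ℂ (Fin 2))))
    (volume : Measure (ℂ × ℂ))
  refine ⟨_, NNReal.coe_pos.mpr hpos, ?_⟩
  rw [ENNReal.ofReal_coe_nnreal]
  exact h

theorem lintegral_exp_neg_mul_norm_sq {κ : ℝ} (hκ : 0 < κ) :
    ∫⁻ w : ℂ, ENNReal.ofReal (Real.exp (-κ * ‖w‖ ^ 2)) = ENNReal.ofReal (Real.pi / κ) := by
  have h : ∫ w : ℂ, Real.exp (-κ * ‖w‖ ^ 2) = Real.pi / κ := by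
    rw [GaussianFourier.integral_rexp_neg_mul_sq_norm hκ, Complex.finrank_real_complex]
    norm_num
  rw [← h, ofReal_integral_eq_lintegral_ofReal]
  · by_contra hcon
    rw [integral_undef hcon] at h
    have : 0 < Real.pi / κ := by positivity
    linarith
  · exact Filter.Eventually.of_forall fun _ => by positivity

theorem coe_nnreal_pi : (NNReal.pi : ENNReal) = ENNReal.ofReal Real.pi :=
  (ENNReal.ofReal_coe_nnreal (p := NNReal.pi)).symm

theorem norm_sq_eq (z : EuclideanSpace ℂ (Fin 2)) : ‖z‖ ^ 2 = ‖z 0‖ ^ 2 + ‖z 1‖ ^ 2 := by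
  rw [EuclideanSpace.norm_sq_eq, Fin.sum_univ_two]

/-- Polar coordinates turn the sphere integral into four times a ball integral (∫₀¹ r³ dr = 1/4).
Passing from x/|x| to x in the ball only increases the Gaussian, and the ball lies in the cylinder
|x₀| ≤ 1, over which the integral factors. -/
theorem exists_lintegral_surface_le : ∃ C : ℝ, 0 ≤ C ∧ ∀ κ : ℝ, 0 < κ →
    ∫⁻ z : USphere 2, ENNReal.ofReal
      (Real.exp (-κ * ‖(z : EuclideanSpace ℂ (Fin 2)) 1‖ ^ 2)) ∂surface 2 ≤
      ENNReal.ofReal (C / κ) := by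
  obtain ⟨m, hm, hmap⟩ := exists_map_coords_volume
  have hdim : Module.finrank ℝ (EuclideanSpace ℂ (Fin 2)) = 4 := by
    rw [← Module.finrank_mul_finrank ℝ ℂ, Complex.finrank_real_complex, finrank_euclideanSpace_fin]
  refine ⟨4 * (m * Real.pi * Real.pi), by positivity, fun κ hκ => ?_⟩
  set f : EuclideanSpace ℂ (Fin 2) → ENNReal := fun z =>
    ENNReal.ofReal (Real.exp (-κ * ‖z 1‖ ^ 2)) with hf
  have hfm : Measurable f := by
    apply Measurable.ennreal_ofReal
    apply Continuous.measurable
    fun_prop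
  have hmp := Measure.measurePreserving_homeomorphUnitSphereProd
    (volume : Measure (EuclideanSpace ℂ (Fin 2)))
  rw [hdim] at hmp
  set one : Set.Ioi (0 : ℝ) := ⟨1, by simp⟩ with hone
  have e1 : (∫⁻ z : USphere 2, f z ∂surface 2) *
      Measure.volumeIoiPow 3 (Set.Iio one) =
      ∫⁻ p : USphere 2 × Set.Ioi (0 : ℝ), f p.1 * (Set.Iio one).indicator 1 p.2
        ∂((surface 2).prod (Measure.volumeIoiPow 3)) := by
    have : IsFiniteMeasure (surface 2) := by unfold surface; infer_instance
    rw [lintegral_prod_mul (f := fun z : USphere 2 => f z)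
      (g := (Set.Iio one).indicator (1 : Set.Ioi (0 : ℝ) → ENNReal)),
      lintegral_indicator_one measurableSet_Iio]
    · exact (hfm.comp measurable_subtype_coe).aemeasurable
    · exact (measurable_one.indicator measurableSet_Iio).aemeasurable
  have e2 : ∫⁻ p : USphere 2 × Set.Ioi (0 : ℝ), f p.1 * (Set.Iio one).indicator 1 p.2
        ∂((surface 2).prod (Measure.volumeIoiPow 3)) =
      ∫⁻ x, f (homeomorphUnitSphereProd (EuclideanSpace ℂ (Fin 2)) x).1 *
        (Set.Iio one).indicator 1 (homeomorphUnitSphereProd (EuclideanSpace ℂ (Fin 2)) x).2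
        ∂((volume : Measure (EuclideanSpace ℂ (Fin 2))).comap (↑)) := by
    refine (hmp.lintegral_comp ?_).symm
    exact (hfm.comp (measurable_subtype_coe.comp measurable_fst)).mul
      ((measurable_one.indicator measurableSet_Iio).comp measurable_snd)
  set H : EuclideanSpace ℂ (Fin 2) → ENNReal := fun x =>
    (Metric.closedBall (0 : ℂ) 1).indicator 1 (x 0) * f x with hH
  have e3 : ∫⁻ x, f (homeomorphUnitSphereProd (EuclideanSpace ℂ (Fin 2)) x).1 *
        (Set.Iio one).indicator 1 (homeomorphUnitSphereProd (EuclideanSpace ℂ (Fin 2)) x).2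
        ∂((volume : Measure (EuclideanSpace ℂ (Fin 2))).comap (↑)) ≤ ∫⁻ x, H x := by
    refine le_trans (lintegral_mono (g := fun x : ({0}ᶜ : Set (EuclideanSpace ℂ (Fin 2))) =>
      H x) ?_) ?_
    · intro x
      by_cases hx : (homeomorphUnitSphereProd (EuclideanSpace ℂ (Fin 2)) x).2 ∈ Set.Iio one
      · have hx' : ‖(x : EuclideanSpace ℂ (Fin 2))‖ < 1 := by
          rw [Set.mem_Iio, ← Subtype.coe_lt_coe] at hx
          simpa [hone] using hx
        have hx0 : 0 < ‖(x : EuclideanSpace ℂ (Fin 2))‖ := norm_pos_iff.mpr x.2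
        have hball : (x : EuclideanSpace ℂ (Fin 2)) 0 ∈ Metric.closedBall (0 : ℂ) 1 := by
          rw [mem_closedBall_zero_iff]
          exact (PiLp.norm_apply_le (x : EuclideanSpace ℂ (Fin 2)) 0).trans hx'.le
        simp only [hH]
        rw [Set.indicator_of_mem hx, Set.indicator_of_mem hball, Pi.one_apply, Pi.one_apply,
          mul_one, one_mul]
        simp only [hf]
        apply ENNReal.ofReal_le_ofReal
        apply Real.exp_le_exp.mpr
        rw [homeomorphUnitSphereProd_apply_fst_coe, PiLp.smul_apply, norm_smul, mul_pow, norm_inv,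
          norm_norm]
        have : 1 ≤ (‖(x : EuclideanSpace ℂ (Fin 2))‖⁻¹) ^ 2 :=
          one_le_pow₀ ((one_le_inv₀ hx0).mpr hx'.le)
        have h2 : 0 ≤ κ * ‖(x : EuclideanSpace ℂ (Fin 2)) 1‖ ^ 2 := by positivity
        nlinarith
      · simp only [Set.indicator_of_notMem hx, mul_zero, zero_le]
    · rw [lintegral_subtype_comap (measurableSet_singleton _).compl]
      exact setLIntegral_le_lintegral _ _
  have e4 : ∫⁻ x, H x = ENNReal.ofReal m * (ENNReal.ofReal Real.pi *
      ENNReal.ofReal (Real.pi / κ)) := by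
    have hG : Measurable fun p : ℂ × ℂ => (Metric.closedBall (0 : ℂ) 1).indicator 1 p.1 *
        ENNReal.ofReal (Real.exp (-κ * ‖p.2‖ ^ 2)) := by
      refine Measurable.mul ((measurable_one.indicator measurableSet_closedBall).comp
        measurable_fst) ?_
      apply Measurable.ennreal_ofReal
      apply Continuous.measurable
      fun_prop
    have := lintegral_map (μ := (volume : Measure (EuclideanSpace ℂ (Fin 2)))) hG
      coords.continuous.measurable
    simp only [coords_apply] at this
    rw [hH, ← this, hmap, lintegral_smul_measure, Measure.volume_eq_prod,
      lintegral_prod_mul (f := (Metric.closedBall (0 : ℂ) 1).indicator 1)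
        (g := fun w : ℂ => ENNReal.ofReal (Real.exp (-κ * ‖w‖ ^ 2))),
      lintegral_exp_neg_mul_norm_sq hκ, lintegral_indicator_one measurableSet_closedBall,
      Complex.volume_closedBall, smul_eq_mul]
    · congr 2
      simp [coe_nnreal_pi]
    · exact (measurable_one.indicator measurableSet_closedBall).aemeasurable
    · apply Measurable.aemeasurable
      apply Measurable.ennreal_ofReal
      apply Continuous.measurable
      fun_prop
  have hfin := (e1.trans e2).trans_le (e3.trans e4.le)
  rw [Measure.volumeIoiPow_apply_Iio, ← ENNReal.ofReal_mul (by positivity),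
    ← ENNReal.ofReal_mul (by positivity)] at hfin
  calc ∫⁻ z : USphere 2, f z ∂surface 2 = ENNReal.ofReal 4 *
        ((∫⁻ z : USphere 2, f z ∂surface 2) *
          ENNReal.ofReal ((one : ℝ) ^ (3 + 1) / ((3 : ℕ) + 1))) := by
        have : ENNReal.ofReal ((one : ℝ) ^ (3 + 1) / ((3 : ℕ) + 1)) * ENNReal.ofReal 4 = 1 := by
          rw [hone, ← ENNReal.ofReal_mul (by norm_num)]
          norm_num
        rw [mul_comm, mul_assoc, this, mul_one]
    _ ≤ ENNReal.ofReal 4 * ENNReal.ofReal (m * (Real.pi * (Real.pi / κ))) := by gcongr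
    _ = _ := by
        rw [← ENNReal.ofReal_mul (by norm_num)]
        congr 1
        ring

open scoped Pointwise in
-- The surface measure of a set is the dimension times the volume of the cone over it, and this cone
-- contains a product of discs of radii 1/8 and √ε/4.
theorem exists_le_surface : ∃ c : ℝ, 0 < c ∧ ∀ ε : ℝ, 0 < ε → ε ≤ 1 →
    ENNReal.ofReal (c * ε) ≤
      surface 2 {z : USphere 2 | ‖(z : EuclideanSpace ℂ (Fin 2)) 1‖ ^ 2 ≤ ε} := by
  obtain ⟨m, hm, hmap⟩ := exists_map_coords_volume
  refine ⟨m * (Real.pi / 64 * (Real.pi / 16)), by positivity, fun ε hε hε1 => ?_⟩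
  set s : Set (USphere 2) := {z : USphere 2 | ‖(z : EuclideanSpace ℂ (Fin 2)) 1‖ ^ 2 ≤ ε} with hs
  have hsm : MeasurableSet s := by
    apply IsClosed.measurableSet
    exact isClosed_le (by fun_prop) continuous_const
  set P : Set (ℂ × ℂ) := Metric.ball (1 / 2 : ℂ) (1 / 8) ×ˢ Metric.ball (0 : ℂ) (√ε / 4) with hP
  have hPm : MeasurableSet P := measurableSet_ball.prod measurableSet_ball
  have hsub : coords ⁻¹' P ⊆ Set.Ioo (0 : ℝ) 1 • (Subtype.val '' s) := by
    intro x hx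
    rw [Set.mem_preimage, coords_apply, hP, Set.mem_prod] at hx
    obtain ⟨h0, h1⟩ := hx
    rw [mem_ball_zero_iff] at h1
    rw [mem_ball_iff_norm] at h0
    simp only at h0 h1
    have hhalf : ‖(1 / 2 : ℂ)‖ = 1 / 2 := by norm_num
    have hlow : 3 / 8 ≤ ‖x 0‖ := by
      have := norm_sub_norm_le (1 / 2 : ℂ) (x 0)
      rw [norm_sub_rev, hhalf] at this
      linarith
    have hup : ‖x 0‖ ≤ 5 / 8 := by
      have := norm_sub_norm_le (x 0) (1 / 2 : ℂ)
      rw [hhalf] at this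
      linarith
    have hx1 : ‖x 1‖ ^ 2 ≤ ε / 16 := by
      have h2 : ‖x 1‖ ^ 2 ≤ (√ε / 4) ^ 2 := by gcongr
      rw [div_pow, Real.sq_sqrt hε.le] at h2
      linarith
    have hn := norm_sq_eq x
    have hn1 : ‖x‖ ^ 2 < 1 := by nlinarith [norm_nonneg (x 0)]
    have hnlow : 1 / 16 ≤ ‖x‖ ^ 2 := by nlinarith [sq_nonneg ‖x 1‖]
    have hnpos : 0 < ‖x‖ := by
      rcases (norm_nonneg x).eq_or_lt with h | h
      · rw [← h] at hnlow; norm_num at hnlow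
      · exact h
    have hlt : ‖x‖ < 1 := by nlinarith
    refine Set.mem_smul.mpr ⟨‖x‖, ⟨hnpos, hlt⟩, ‖x‖⁻¹ • x,
      ⟨⟨‖x‖⁻¹ • x, by simp [norm_smul, hnpos.ne']⟩, ?_, rfl⟩, ?_⟩
    · simp only [hs, Set.mem_ofPred_eq, PiLp.smul_apply, norm_smul, norm_inv, norm_norm, mul_pow]
      rw [inv_pow, inv_mul_le_iff₀ (by positivity)]
      nlinarith
    · rw [smul_smul, mul_inv_cancel₀ hnpos.ne', one_smul]
  rw [surface, Measure.toSphere_apply' _ hsm]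
  have hvol : (volume : Measure (EuclideanSpace ℂ (Fin 2))) (coords ⁻¹' P) =
      ENNReal.ofReal (m * (Real.pi / 64 * (Real.pi / 16)) * ε) := by
    rw [← Measure.map_apply coords.continuous.measurable hPm, hmap, Measure.smul_apply, smul_eq_mul,
      hP, Measure.volume_eq_prod, Measure.prod_prod, Complex.volume_ball, Complex.volume_ball]
    rw [coe_nnreal_pi, ← ENNReal.ofReal_pow (by norm_num), ← ENNReal.ofReal_pow (by positivity),
      ← ENNReal.ofReal_mul (by positivity), ← ENNReal.ofReal_mul (by positivity),
      ← ENNReal.ofReal_mul (by positivity), ← ENNReal.ofReal_mul (by positivity), div_pow √ε,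
      Real.sq_sqrt hε.le]
    congr 1
    ring
  have hdim : (1 : ENNReal) ≤ (Module.finrank ℝ (EuclideanSpace ℂ (Fin 2)) : ENNReal) := by
    have : 0 < Module.finrank ℝ (EuclideanSpace ℂ (Fin 2)) := Module.finrank_pos
    exact_mod_cast this
  calc _ = 1 * (volume : Measure (EuclideanSpace ℂ (Fin 2))) (coords ⁻¹' P) := by
        rw [hvol, one_mul]
    _ ≤ _ := by gcongr

/-! ### Comparison in L². -/

instance : IsFiniteMeasure (surface 2) := by unfold surface; infer_instance

theorem continuous_reducedState (k : ℕ) (a b c : ℂ) :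
    Continuous (reducedState k !![a, c; c, b] north) := by
  rw [funext (reducedState_eq_reducedInt k a b c)]
  unfold reducedInt
  refine continuous_const.mul
    (intervalIntegral.continuous_parametric_intervalIntegral_of_continuous' ?_ _ _)
  unfold Function.uncurry phase
  fun_prop

theorem memLp_reducedState (k : ℕ) (a b c : ℂ) :
    MemLp (reducedState k !![a, c; c, b] north) 2 (surface 2) :=
  (continuous_reducedState k a b c).memLp_of_hasCompactSupport (HasCompactSupport.of_compactSpace _)

theorem norm_sq_add_norm_sq_eq_one (z : USphere 2) :
    ‖(z : EuclideanSpace ℂ (Fin 2)) 0‖ ^ 2 + ‖(z : EuclideanSpace ℂ (Fin 2)) 1‖ ^ 2 = 1 := by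
  rw [← norm_sq_eq]; simp

theorem eLpNorm_two_sq {α : Type*} [MeasurableSpace α] (μ : Measure α) (f : α → ℂ) :
    eLpNorm f 2 μ ^ 2 = ∫⁻ x, ENNReal.ofReal (‖f x‖ ^ 2) ∂μ := by
  have h := eLpNorm_nnreal_pow_eq_lintegral (f := f) (μ := μ) (p := 2) (by norm_num)
  have e : ((2 : NNReal) : ℝ) = ((2 : ℕ) : ℝ) := by norm_num
  rw [e] at h
  simp only [ENNReal.rpow_natCast] at h
  rw [show ((2 : NNReal) : ENNReal) = 2 by norm_num] at h
  rw [h]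
  refine lintegral_congr fun x => ?_
  rw [ENNReal.ofReal_pow (norm_nonneg _), ofReal_norm]

theorem exists_eLpNorm_reducedState_sub_le {a b c : ℂ} {δ : ℝ} (hδ : 0 < δ)
    (h : ∀ x y : ℂ,
      (a * x ^ 2 + 2 * c * x * y + b * y ^ 2).re ≤ (1 - δ) * (‖x‖ ^ 2 + ‖y‖ ^ 2)) :
    ∃ C : ℝ, ∀ k : ℕ, 1 ≤ k →
      eLpNorm (fun z : USphere 2 => reducedState k !![a, c; c, b] north z -
          (1 + a) ^ (-(1 / 2) : ℂ) *
            reducedState k !![0, 0; 0, b - c ^ 2 / (1 + a)] north z) 2 (surface 2) ≤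
        ENNReal.ofReal (C / √(k : ℝ)) *
          eLpNorm (reducedState k !![0, 0; 0, b - c ^ 2 / (1 + a)] north) 2 (surface 2) := by
  have hμ := norm_schur_lt_one hδ h
  obtain ⟨C, κ, hC, hκ, H⟩ := exists_norm_reducedInt_sub_reducedInt_le hδ h
  set μ := b - c ^ 2 / (1 + a)
  obtain ⟨S, hS, HS⟩ := exists_lintegral_surface_le
  obtain ⟨s, hs, Hs⟩ := exists_le_surface
  set d : ℝ := 3 / (8 * Real.exp 1) with hd
  have hd0 : 0 < d := by positivity
  -- Quotient of the constants in the bounds k⁻³ from above and k⁻² from below for the squared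
  -- norms.
  set R : ℝ := (C ^ 2 * (S / (2 * κ))) / (d ^ 2 * (s / 4)) with hR
  have hR0 : 0 ≤ R := by positivity
  refine ⟨√R, fun k hk => ?_⟩
  have hkpos : (0 : ℝ) < k := by exact_mod_cast hk
  have hk1 : (1 : ℝ) ≤ k := by exact_mod_cast hk
  rw [← ENNReal.pow_le_pow_left_iff two_ne_zero, mul_pow, eLpNorm_two_sq, eLpNorm_two_sq]
  have hupper : ∫⁻ z : USphere 2, ENNReal.ofReal (‖reducedState k !![a, c; c, b] north z -
      (1 + a) ^ (-(1 / 2) : ℂ) * reducedState k !![0, 0; 0, μ] north z‖ ^ 2) ∂surface 2 ≤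
      ENNReal.ofReal ((C / k) ^ 2 * (S / (2 * κ * k))) := by
    calc _ ≤ ∫⁻ z : USphere 2, ENNReal.ofReal ((C / k) ^ 2) * ENNReal.ofReal
          (Real.exp (-(2 * κ * k) * ‖(z : EuclideanSpace ℂ (Fin 2)) 1‖ ^ 2)) ∂surface 2 := by
          refine lintegral_mono fun z => ?_
          rw [← ENNReal.ofReal_mul (by positivity)]
          apply ENNReal.ofReal_le_ofReal
          rw [reducedState_eq_reducedInt, reducedState_eq_reducedInt]
          have h1 := H k hk _ _ (norm_sq_add_norm_sq_eq_one z)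
          refine (pow_le_pow_left₀ (norm_nonneg _) h1 2).trans (le_of_eq ?_)
          rw [mul_pow, ← Real.exp_nat_mul]
          congr 2
          push_cast
          ring
      _ ≤ ENNReal.ofReal ((C / k) ^ 2) * ENNReal.ofReal (S / (2 * κ * k)) := by
          rw [lintegral_const_mul' _ _ ENNReal.ofReal_ne_top]
          gcongr
          exact HS _ (by positivity)
      _ = _ := by rw [ENNReal.ofReal_mul (by positivity)]
  have hlower : ENNReal.ofReal ((d / √k) ^ 2 * (s * (1 / (4 * k)))) ≤
      ∫⁻ z : USphere 2, ENNReal.ofReal (‖reducedState k !![0, 0; 0, μ] north z‖ ^ 2)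
        ∂surface 2 := by
    set T : Set (USphere 2) :=
      {z : USphere 2 | ‖(z : EuclideanSpace ℂ (Fin 2)) 1‖ ^ 2 ≤ 1 / (4 * k)} with hT
    have hTm : MeasurableSet T := (isClosed_le (by fun_prop) continuous_const).measurableSet
    have h4 : 1 / (4 * (k : ℝ)) ≤ 1 := by
      rw [div_le_one (by positivity)]; linarith
    calc _ = ENNReal.ofReal ((d / √k) ^ 2) * ENNReal.ofReal (s * (1 / (4 * k))) :=
          ENNReal.ofReal_mul (by positivity)
      _ ≤ ENNReal.ofReal ((d / √k) ^ 2) * surface 2 T := by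
          gcongr
          exact Hs _ (by positivity) h4
      _ = ∫⁻ _ in T, ENNReal.ofReal ((d / √k) ^ 2) ∂surface 2 := by rw [setLIntegral_const]
      _ ≤ ∫⁻ z in T, ENNReal.ofReal (‖reducedState k !![0, 0; 0, μ] north z‖ ^ 2)
            ∂surface 2 := by
          refine setLIntegral_mono' hTm fun z hz => ?_
          apply ENNReal.ofReal_le_ofReal
          rw [reducedState_eq_reducedInt]
          exact pow_le_pow_left₀ (by positivity)
            (le_norm_reducedInt_diag hμ hk (norm_sq_add_norm_sq_eq_one z) hz) 2
      _ ≤ _ := setLIntegral_le_lintegral _ _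
  refine hupper.trans (le_trans (le_of_eq ?_) (mul_le_mul_right hlower _))
  rw [← ENNReal.ofReal_pow (by positivity), ← ENNReal.ofReal_mul (by positivity)]
  congr 1
  rw [div_pow, div_pow, div_pow, Real.sq_sqrt hR0, Real.sq_sqrt hkpos.le, hR]
  field_simp

end ReducedGaussian

theorem proposition1p6 :
    -- the expansion of the reduced state of `[μ] = diag(0, μ)` at `(1, 0)`
    (∀ μ : ℂ, ‖μ‖ < 1 → ∀ k : ℕ, 1 ≤ k → ∀ z : ReducedGaussian.USphere 2,
      ReducedGaussian.reducedState k !![0, 0; 0, μ] ReducedGaussian.north z =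
        ((Real.pi * (k : ℝ) ^ k * Real.exp (-(k : ℝ)) *
            √(2 / (((k + 1).factorial : ℕ) : ℝ)) : ℝ) : ℂ) *
          ∑ l ∈ Finset.range (k / 2 + 1),
            (1 / (2 * (k : ℂ))) ^ l *
              ((1 / √(((k - 2 * l).factorial : ℕ) : ℝ) : ℝ) : ℂ) *
              ((√(((2 * l).choose l : ℕ) : ℝ) : ℝ) : ℂ) * μ ^ l *
              ReducedGaussian.ket k (k - 2 * l) z) ∧
    -- the general case
    (∀ a b c : ℂ, !![a, c; c, b] ∈ ReducedGaussian.Disk 2 →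
      ∀ μ : ℂ, μ = b - c ^ 2 / (1 + a) →
        0 < (1 + a).re ∧ ‖μ‖ < 1 ∧
        -- `μ` is the parameter of the symbol
        (∀ ζ : ℂ,
          ReducedGaussian.gaussianSymbol !![a, c; c, b] ReducedGaussian.north
              (EuclideanSpace.single 1 ζ) =
            ((1 / √(2 * Real.pi) : ℝ) : ℂ) * (1 + a) ^ (-(1 / 2) : ℂ) *
              Complex.exp (μ * ζ ^ 2 / 2) * Complex.exp (-(‖ζ‖ : ℂ) ^ 2 / 2)) ∧
        -- the two states agree, in the norm of `L²(S³)`, up to a relative error `O(k^{-1/2})`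
        ∃ C : ℝ, ∀ k : ℕ, 1 ≤ k →
          MeasureTheory.MemLp
            (ReducedGaussian.reducedState k !![a, c; c, b] ReducedGaussian.north) 2
            (ReducedGaussian.surface 2) ∧
          MeasureTheory.MemLp
            (ReducedGaussian.reducedState k !![0, 0; 0, μ] ReducedGaussian.north) 2
            (ReducedGaussian.surface 2) ∧
          MeasureTheory.eLpNorm
              (fun z : ReducedGaussian.USphere 2 =>
                ReducedGaussian.reducedState k !![a, c; c, b] ReducedGaussian.north z -
                  (1 + a) ^ (-(1 / 2) : ℂ) *
                    ReducedGaussian.reducedState k !![0, 0; 0, μ] ReducedGaussian.north z)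
              2 (ReducedGaussian.surface 2) ≤
            ENNReal.ofReal (C / √(k : ℝ)) *
              MeasureTheory.eLpNorm
                (ReducedGaussian.reducedState k !![0, 0; 0, μ] ReducedGaussian.north) 2
                (ReducedGaussian.surface 2)) := by
  refine ⟨fun μ _ k hk z => ReducedGaussian.reducedState_diag_eq_sum_ket μ k hk z, ?_⟩
  rintro a b c hA _ rfl
  obtain ⟨δ, hδ, h⟩ := ReducedGaussian.exists_re_quadForm_le_of_mem_disk hA
  have ha := ReducedGaussian.re_one_add_pos hδ h
  refine ⟨ha, ReducedGaussian.norm_schur_lt_one hδ h,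
    ReducedGaussian.gaussianSymbol_eq ha, ?_⟩
  obtain ⟨C, hC⟩ := ReducedGaussian.exists_eLpNorm_reducedState_sub_le hδ h
  exact ⟨C, fun k hk => ⟨ReducedGaussian.memLp_reducedState k a b c,
    ReducedGaussian.memLp_reducedState k 0 _ 0, hC k hk⟩⟩
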